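/- Work with formal short normal-play games $G=\{G^L\mid G^R\}$ (finitely many Left options $G^L$ and Right options $G^R$, each again such a game). Sums are disjunctive sums; equality $G=H$ of games means equality of game values ($G\le H$ and $H\le G$, where $G\le H$ iff no $G^L$ satisfies $H\le G^L$ and no $H^R$ satisfies $H^R\le G$). Let $\mathbb G$ be the abelian group of game values, and regard every dyadic rational $q\in\mathbb Z[\tfrac12]$ also as a game, via its canonical form. For a formal game $G$ and $t\in\mathbb Z[\tfrac12]$, define $\lambda_t(G),\rho_t(G)\in\mathbb Z[\tfrac12]$, the cooled game $G_t$, and the temperature $t(G)\in\mathbb Z[\tfrac12]\cup\{-\infty\}$ recursively as follows. 1. If $G$ is equal to an integer $n$, put $\lambda_t(G)=\rho_t(G)=n$, $G_t=n$ for all $t$, and $t(G)=-\infty$. 2. Otherwise, put $$\tilde\lambda_t(G)=\max_{G^L}\bigl(\rho_t(G^L)-t\bigr),\qquad \tilde\rho_t(G)=\min_{G^R}\bigl(\lambda_t(G^R)+t\bigr),\qquad \tilde G_t=\{(G^L)_t-t\mid (G^R)_t+t\},$$ and let $t(G)$ be the least $s\in\mathbb Z[\tfrac12]$ with $\tilde\lambda_s(G)=\tilde\rho_s(G)$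 (such a least $s$ exists); let $x$ be the common value $\tilde\lambda_{t(G)}(G)=\tilde\rho_{t(G)}(G)$. For $t\le t(G)$ put $\lambda_t(G)=\tilde\lambda_t(G)$, $\rho_t(G)=\tilde\rho_t(G)$, $G_t=\tilde G_t$; for $t>t(G)$ put $\lambda_t(G)=\rho_t(G)=x$ and $G_t=x$. **Theorem.** Let $t\in\mathbb Z[\tfrac12]$ with $t>-1$. Then for all formal games $G,H$, $$(G+H)_t=G_t+H_t .$$ Moreover $G\mapsto G_t$ induces a well-defined map $\mathbb G\to\mathbb G$, and this map is a group homomorphism. -/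

import Mathlib

/-- The ring `ℤ[1/2]` of dyadic rationals, as a subring of `ℚ`. -/
def dyadicSubring : Subring ℚ where
  carrier := {q | ∃ (k : ℤ) (m : ℕ), q = k / 2 ^ m}
  zero_mem' := ⟨0, 0, by simp⟩
  one_mem' := ⟨1, 0, by simp⟩
  add_mem' := by
    rintro _ _ ⟨a, m, rfl⟩ ⟨b, n, rfl⟩
    refine ⟨a * 2 ^ n + b * 2 ^ m, m + n, ?_⟩
    push_cast
    rw [pow_add]
    field_simp
  mul_mem' := by
    rintro _ _ ⟨a, m, rfl⟩ ⟨b, n, rfl⟩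
    refine ⟨a * b, m + n, ?_⟩
    push_cast
    rw [pow_add]
    field_simp
  neg_mem' := by
    rintro _ ⟨a, m, rfl⟩
    refine ⟨-a, m, ?_⟩
    push_cast
    ring

/-- The ordered ring `ℤ[1/2]`. -/
abbrev DyadicRat : Type := dyadicSubring

/-- Formal short (finite, loopfree) two-player games: a position is given by its finitely many Left
options `L i` and its finitely many Right options `R j`. -/
inductive ShortGame : Type
  | mk (m n : ℕ) (L : Fin m → ShortGame) (R : Fin n → ShortGame) : ShortGame

namespace ShortGame

/-- The formal birthday: `0` if there are no options, otherwise one more than the largest formal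
birthday of an option. -/
def birthday : ShortGame → ℕ
  | mk _ _ L R =>
    max (Finset.univ.sup fun i => (L i).birthday + 1) (Finset.univ.sup fun j => (R j).birthday + 1)

theorem birthday_left_lt {m n : ℕ} (L : Fin m → ShortGame) (R : Fin n → ShortGame) (i : Fin m) :
    (L i).birthday < (mk m n L R).birthday := by
  rw [birthday]
  exact lt_of_lt_of_le (Nat.lt_succ_self _) (le_max_of_le_left
    (Finset.le_sup (f := fun i => (L i).birthday + 1) (Finset.mem_univ i)))

theorem birthday_right_lt {m n : ℕ} (L : Fin m → ShortGame) (R : Fin n → ShortGame) (j : Fin n) :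
    (R j).birthday < (mk m n L R).birthday := by
  rw [birthday]
  exact lt_of_lt_of_le (Nat.lt_succ_self _) (le_max_of_le_right
    (Finset.le_sup (f := fun j => (R j).birthday + 1) (Finset.mem_univ j)))

/-- `G ≤ H` iff no Left option `G^L` satisfies `H ≤ G^L` and no Right option `H^R` satisfies
`H^R ≤ G`. -/
def le : ShortGame → ShortGame → Prop
  | mk a b xL xR, mk c d yL yR =>
    (∀ i, ¬ le (mk c d yL yR) (xL i)) ∧ (∀ j, ¬ le (yR j) (mk a b xL xR))
termination_by x y => x.birthday + y.birthday
decreasing_by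
  · have := birthday_left_lt xL xR i; omega
  · have := birthday_right_lt yL yR j; omega

instance : LE ShortGame := ⟨le⟩

/-- The game `0 = { | }`. -/
instance : Zero ShortGame := ⟨mk 0 0 Fin.elim0 Fin.elim0⟩

/-- The negative `-G = {-G^R | -G^L}`. -/
def neg : ShortGame → ShortGame
  | mk m n L R => mk n m (fun j => neg (R j)) (fun i => neg (L i))

instance : Neg ShortGame := ⟨neg⟩

/-- The disjunctive sum `G + H = {G^L + H, G + H^L | G^R + H, G + H^R}`. -/
def add : ShortGame → ShortGame → ShortGame
  | mk a b xL xR, mk c d yL yR =>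
    mk (a + c) (b + d)
      (Fin.append (fun i => add (xL i) (mk c d yL yR)) (fun i => add (mk a b xL xR) (yL i)))
      (Fin.append (fun j => add (xR j) (mk c d yL yR)) (fun j => add (mk a b xL xR) (yR j)))
termination_by x y => x.birthday + y.birthday
decreasing_by
  · have := birthday_left_lt xL xR i; omega
  · have := birthday_left_lt yL yR i; omega
  · have := birthday_right_lt xL xR j; omega
  · have := birthday_right_lt yL yR j; omega

instance : Add ShortGame := ⟨add⟩

instance : Sub ShortGame := ⟨fun G H => G + -H⟩

/-! ### Basic facts: games modulo equality form an abelian group -/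

/-- `x` is a Left option of `G`. -/
def IsLeft (x : ShortGame) : ShortGame → Prop
  | mk _ _ L _ => ∃ i, x = L i

/-- `x` is a Right option of `G`. -/
def IsRight (x : ShortGame) : ShortGame → Prop
  | mk _ _ _ R => ∃ j, x = R j

theorem IsLeft.lt {x G : ShortGame} (h : IsLeft x G) : x.birthday < G.birthday := by
  cases G; obtain ⟨i, rfl⟩ := h; exact birthday_left_lt _ _ i

theorem IsRight.lt {x G : ShortGame} (h : IsRight x G) : x.birthday < G.birthday := by
  cases G; obtain ⟨i, rfl⟩ := h; exact birthday_right_lt _ _ i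

theorem le_iff {x y : ShortGame} :
    x ≤ y ↔ (∀ z, IsLeft z x → ¬ y ≤ z) ∧ (∀ z, IsRight z y → ¬ z ≤ x) := by
  cases x; cases y
  change le _ _ ↔ _
  rw [le]
  simp only [IsLeft, IsRight]
  constructor
  · rintro ⟨h₁, h₂⟩
    refine ⟨?_, ?_⟩
    · rintro _ ⟨i, rfl⟩; exact h₁ i
    · rintro _ ⟨i, rfl⟩; exact h₂ i
  · rintro ⟨h₁, h₂⟩
    exact ⟨fun i => h₁ _ ⟨i, rfl⟩, fun i => h₂ _ ⟨i, rfl⟩⟩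

theorem not_isLeft_zero {z : ShortGame} : ¬ IsLeft z 0 := fun ⟨i, _⟩ => i.elim0

theorem not_isRight_zero {z : ShortGame} : ¬ IsRight z 0 := fun ⟨i, _⟩ => i.elim0

theorem isLeft_neg {z x : ShortGame} : IsLeft z (-x) ↔ ∃ w, IsRight w x ∧ z = -w := by
  cases x
  constructor
  · rintro ⟨i, rfl⟩; exact ⟨_, ⟨i, rfl⟩, rfl⟩
  · rintro ⟨_, ⟨i, rfl⟩, rfl⟩; exact ⟨i, rfl⟩

theorem isRight_neg {z x : ShortGame} : IsRight z (-x) ↔ ∃ w, IsLeft w x ∧ z = -w := by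
  cases x
  constructor
  · rintro ⟨i, rfl⟩; exact ⟨_, ⟨i, rfl⟩, rfl⟩
  · rintro ⟨_, ⟨i, rfl⟩, rfl⟩; exact ⟨i, rfl⟩

theorem isLeft_add {z x y : ShortGame} :
    IsLeft z (x + y) ↔ (∃ w, IsLeft w x ∧ z = w + y) ∨ (∃ w, IsLeft w y ∧ z = x + w) := by
  obtain ⟨a, b, xL, xR⟩ := x
  obtain ⟨c, d, yL, yR⟩ := y
  change IsLeft z (add _ _) ↔ _
  rw [add]
  constructor
  · rintro ⟨i, rfl⟩
    refine Fin.addCases (fun i => ?_) (fun i => ?_) i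
    · exact Or.inl ⟨xL i, ⟨i, rfl⟩, by rw [Fin.append_left]; rfl⟩
    · exact Or.inr ⟨yL i, ⟨i, rfl⟩, by rw [Fin.append_right]; rfl⟩
  · rintro (⟨_, ⟨i, rfl⟩, rfl⟩ | ⟨_, ⟨i, rfl⟩, rfl⟩)
    · exact ⟨Fin.castAdd c i, by rw [Fin.append_left]; rfl⟩
    · exact ⟨Fin.natAdd a i, by rw [Fin.append_right]; rfl⟩

theorem isRight_add {z x y : ShortGame} :
    IsRight z (x + y) ↔ (∃ w, IsRight w x ∧ z = w + y) ∨ (∃ w, IsRight w y ∧ z = x + w) := by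
  obtain ⟨a, b, xL, xR⟩ := x
  obtain ⟨c, d, yL, yR⟩ := y
  change IsRight z (add _ _) ↔ _
  rw [add]
  constructor
  · rintro ⟨i, rfl⟩
    refine Fin.addCases (fun i => ?_) (fun i => ?_) i
    · exact Or.inl ⟨xR i, ⟨i, rfl⟩, by rw [Fin.append_left]; rfl⟩
    · exact Or.inr ⟨yR i, ⟨i, rfl⟩, by rw [Fin.append_right]; rfl⟩
  · rintro (⟨_, ⟨i, rfl⟩, rfl⟩ | ⟨_, ⟨i, rfl⟩, rfl⟩)
    · exact ⟨Fin.castAdd d i, by rw [Fin.append_left]; rfl⟩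
    · exact ⟨Fin.natAdd b i, by rw [Fin.append_right]; rfl⟩

protected theorem le_refl (x : ShortGame) : x ≤ x := by
  rw [le_iff]
  refine ⟨fun z hz h => ?_, fun z hz h => ?_⟩
  · have := hz.lt
    exact (le_iff.1 h).1 z hz (ShortGame.le_refl z)
  · have := hz.lt
    exact (le_iff.1 h).2 z hz (ShortGame.le_refl z)
termination_by x.birthday

protected theorem le_trans {x y z : ShortGame} (h₁ : x ≤ y) (h₂ : y ≤ z) : x ≤ z := by
  rw [le_iff]
  refine ⟨fun w hw h => ?_, fun w hw h => ?_⟩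
  · have := hw.lt
    exact (le_iff.1 h₁).1 w hw (ShortGame.le_trans h₂ h)
  · have := hw.lt
    exact (le_iff.1 h₂).2 w hw (ShortGame.le_trans h h₁)
termination_by x.birthday + y.birthday + z.birthday

instance : Preorder ShortGame where
  le_refl := ShortGame.le_refl
  le_trans _ _ _ := ShortGame.le_trans

/-- Equality of game values: `G = H` iff `G ≤ H` and `H ≤ G`. -/
instance setoid : Setoid ShortGame := AntisymmRel.setoid ShortGame (· ≤ ·)

theorem equiv_iff {x y : ShortGame} : x ≈ y ↔ x ≤ y ∧ y ≤ x := Iff.rfl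

theorem neg_le_neg_iff (x y : ShortGame) : -y ≤ -x ↔ x ≤ y := by
  rw [le_iff, le_iff (x := x)]
  constructor
  · rintro ⟨h₁, h₂⟩
    refine ⟨fun z hz h => ?_, fun z hz h => ?_⟩
    · have := hz.lt
      exact h₂ (-z) (isRight_neg.2 ⟨z, hz, rfl⟩) ((neg_le_neg_iff y z).2 h)
    · have := hz.lt
      exact h₁ (-z) (isLeft_neg.2 ⟨z, hz, rfl⟩) ((neg_le_neg_iff z x).2 h)
  · rintro ⟨h₁, h₂⟩
    refine ⟨fun z hz h => ?_, fun z hz h => ?_⟩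
    · obtain ⟨w, hw, rfl⟩ := isLeft_neg.1 hz
      have := hw.lt
      exact h₂ w hw ((neg_le_neg_iff w x).1 h)
    · obtain ⟨w, hw, rfl⟩ := isRight_neg.1 hz
      have := hw.lt
      exact h₁ w hw ((neg_le_neg_iff y w).1 h)
termination_by x.birthday + y.birthday

theorem add_comm_le (x y : ShortGame) : x + y ≤ y + x := by
  rw [le_iff]
  refine ⟨fun z hz h => ?_, fun z hz h => ?_⟩
  · rcases isLeft_add.1 hz with ⟨w, hw, rfl⟩ | ⟨w, hw, rfl⟩
    · have := hw.lt
      exact (le_iff.1 h).1 _ (isLeft_add.2 (.inr ⟨w, hw, rfl⟩)) (add_comm_le w y)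
    · have := hw.lt
      exact (le_iff.1 h).1 _ (isLeft_add.2 (.inl ⟨w, hw, rfl⟩)) (add_comm_le x w)
  · rcases isRight_add.1 hz with ⟨w, hw, rfl⟩ | ⟨w, hw, rfl⟩
    · have := hw.lt
      exact (le_iff.1 h).2 _ (isRight_add.2 (.inr ⟨w, hw, rfl⟩)) (add_comm_le x w)
    · have := hw.lt
      exact (le_iff.1 h).2 _ (isRight_add.2 (.inl ⟨w, hw, rfl⟩)) (add_comm_le w y)
termination_by x.birthday + y.birthday

theorem add_assoc_equiv (x y z : ShortGame) : x + y + z ≤ x + (y + z) ∧ x + (y + z) ≤ x + y + z := by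
  have hx : ∀ w : ShortGame, w.birthday < x.birthday → w + y + z ≤ w + (y + z) ∧ w + (y + z) ≤ w + y + z :=
    fun w _ => add_assoc_equiv w y z
  have hy : ∀ w : ShortGame, w.birthday < y.birthday → x + w + z ≤ x + (w + z) ∧ x + (w + z) ≤ x + w + z :=
    fun w _ => add_assoc_equiv x w z
  have hz : ∀ w : ShortGame, w.birthday < z.birthday → x + y + w ≤ x + (y + w) ∧ x + (y + w) ≤ x + y + w :=
    fun w _ => add_assoc_equiv x y w
  constructor
  · rw [le_iff]
    refine ⟨fun v hv h => ?_, fun v hv h => ?_⟩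
    · rcases isLeft_add.1 hv with ⟨u, hu, rfl⟩ | ⟨w, hw, rfl⟩
      · rcases isLeft_add.1 hu with ⟨w, hw, rfl⟩ | ⟨w, hw, rfl⟩
        · exact (le_iff.1 h).1 _ (isLeft_add.2 (.inl ⟨w, hw, rfl⟩)) (hx w hw.lt).1
        · exact (le_iff.1 h).1 _ (isLeft_add.2 (.inr ⟨_, isLeft_add.2 (.inl ⟨w, hw, rfl⟩), rfl⟩))
            (hy w hw.lt).1
      · exact (le_iff.1 h).1 _ (isLeft_add.2 (.inr ⟨_, isLeft_add.2 (.inr ⟨w, hw, rfl⟩), rfl⟩))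
          (hz w hw.lt).1
    · rcases isRight_add.1 hv with ⟨w, hw, rfl⟩ | ⟨u, hu, rfl⟩
      · exact (le_iff.1 h).2 _ (isRight_add.2 (.inl ⟨_, isRight_add.2 (.inl ⟨w, hw, rfl⟩), rfl⟩))
          (hx w hw.lt).1
      · rcases isRight_add.1 hu with ⟨w, hw, rfl⟩ | ⟨w, hw, rfl⟩
        · exact (le_iff.1 h).2 _ (isRight_add.2 (.inl ⟨_, isRight_add.2 (.inr ⟨w, hw, rfl⟩), rfl⟩))
            (hy w hw.lt).1
        · exact (le_iff.1 h).2 _ (isRight_add.2 (.inr ⟨w, hw, rfl⟩)) (hz w hw.lt).1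
  · rw [le_iff]
    refine ⟨fun v hv h => ?_, fun v hv h => ?_⟩
    · rcases isLeft_add.1 hv with ⟨w, hw, rfl⟩ | ⟨u, hu, rfl⟩
      · exact (le_iff.1 h).1 _ (isLeft_add.2 (.inl ⟨_, isLeft_add.2 (.inl ⟨w, hw, rfl⟩), rfl⟩))
          (hx w hw.lt).2
      · rcases isLeft_add.1 hu with ⟨w, hw, rfl⟩ | ⟨w, hw, rfl⟩
        · exact (le_iff.1 h).1 _ (isLeft_add.2 (.inl ⟨_, isLeft_add.2 (.inr ⟨w, hw, rfl⟩), rfl⟩))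
            (hy w hw.lt).2
        · exact (le_iff.1 h).1 _ (isLeft_add.2 (.inr ⟨w, hw, rfl⟩)) (hz w hw.lt).2
    · rcases isRight_add.1 hv with ⟨u, hu, rfl⟩ | ⟨w, hw, rfl⟩
      · rcases isRight_add.1 hu with ⟨w, hw, rfl⟩ | ⟨w, hw, rfl⟩
        · exact (le_iff.1 h).2 _ (isRight_add.2 (.inl ⟨w, hw, rfl⟩)) (hx w hw.lt).2
        · exact (le_iff.1 h).2 _ (isRight_add.2 (.inr ⟨_, isRight_add.2 (.inl ⟨w, hw, rfl⟩), rfl⟩))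
            (hy w hw.lt).2
      · exact (le_iff.1 h).2 _ (isRight_add.2 (.inr ⟨_, isRight_add.2 (.inr ⟨w, hw, rfl⟩), rfl⟩))
          (hz w hw.lt).2
termination_by x.birthday + y.birthday + z.birthday

theorem add_zero_equiv (x : ShortGame) : x + 0 ≤ x ∧ x ≤ x + 0 := by
  have hx : ∀ w : ShortGame, w.birthday < x.birthday → w + 0 ≤ w ∧ w ≤ w + 0 := fun w _ => add_zero_equiv w
  constructor
  · rw [le_iff]
    refine ⟨fun v hv h => ?_, fun w hw h => ?_⟩
    · rcases isLeft_add.1 hv with ⟨w, hw, rfl⟩ | ⟨w, hw, rfl⟩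
      · exact (le_iff.1 h).1 w hw (hx w hw.lt).1
      · exact not_isLeft_zero hw
    · exact (le_iff.1 h).2 _ (isRight_add.2 (.inl ⟨w, hw, rfl⟩)) (hx w hw.lt).1
  · rw [le_iff]
    refine ⟨fun w hw h => ?_, fun v hv h => ?_⟩
    · exact (le_iff.1 h).1 _ (isLeft_add.2 (.inl ⟨w, hw, rfl⟩)) (hx w hw.lt).2
    · rcases isRight_add.1 hv with ⟨w, hw, rfl⟩ | ⟨w, hw, rfl⟩
      · exact (le_iff.1 h).2 w hw (hx w hw.lt).2
      · exact not_isRight_zero hw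
termination_by x.birthday

theorem not_le_iff {x y : ShortGame} :
    ¬ x ≤ y ↔ (∃ z, IsLeft z x ∧ y ≤ z) ∨ (∃ z, IsRight z y ∧ z ≤ x) := by
  rw [le_iff, not_and_or]
  push Not
  rfl

theorem add_le_add_right_game {x y : ShortGame} (h : x ≤ y) (z : ShortGame) : x + z ≤ y + z := by
  rw [le_iff]
  refine ⟨fun v hv hle => ?_, fun v hv hle => ?_⟩
  · rcases isLeft_add.1 hv with ⟨w, hw, rfl⟩ | ⟨w, hw, rfl⟩
    · have := hw.lt
      rcases not_le_iff.1 ((le_iff.1 h).1 w hw) with ⟨u, hu, hwu⟩ | ⟨u, hu, huy⟩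
      · have := hu.lt
        exact (le_iff.1 hle).1 _ (isLeft_add.2 (.inl ⟨u, hu, rfl⟩)) (add_le_add_right_game hwu z)
      · have := hu.lt
        exact (le_iff.1 hle).2 _ (isRight_add.2 (.inl ⟨u, hu, rfl⟩)) (add_le_add_right_game huy z)
    · have := hw.lt
      exact (le_iff.1 hle).1 _ (isLeft_add.2 (.inr ⟨w, hw, rfl⟩)) (add_le_add_right_game h w)
  · rcases isRight_add.1 hv with ⟨w, hw, rfl⟩ | ⟨w, hw, rfl⟩
    · have := hw.lt
      rcases not_le_iff.1 ((le_iff.1 h).2 w hw) with ⟨u, hu, hxu⟩ | ⟨u, hu, hux⟩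
      · have := hu.lt
        exact (le_iff.1 hle).1 _ (isLeft_add.2 (.inl ⟨u, hu, rfl⟩)) (add_le_add_right_game hxu z)
      · have := hu.lt
        exact (le_iff.1 hle).2 _ (isRight_add.2 (.inl ⟨u, hu, rfl⟩)) (add_le_add_right_game hux z)
    · have := hw.lt
      exact (le_iff.1 hle).2 _ (isRight_add.2 (.inr ⟨w, hw, rfl⟩)) (add_le_add_right_game h w)
termination_by x.birthday + y.birthday + z.birthday

theorem add_le_add_game {x y x' y' : ShortGame} (h : x ≤ y) (h' : x' ≤ y') : x + x' ≤ y + y' :=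
  (add_le_add_right_game h x').trans <| (add_comm_le _ _).trans <|
    (add_le_add_right_game h' y).trans (add_comm_le _ _)

theorem neg_add_equiv (x : ShortGame) : -x + x ≤ 0 ∧ 0 ≤ -x + x := by
  have hx : ∀ w : ShortGame, w.birthday < x.birthday → -w + w ≤ 0 ∧ 0 ≤ -w + w := fun w _ => neg_add_equiv w
  constructor
  · rw [le_iff]
    refine ⟨fun v hv h => ?_, fun w hw _ => not_isRight_zero hw⟩
    rcases isLeft_add.1 hv with ⟨u, hu, rfl⟩ | ⟨w, hw, rfl⟩
    · obtain ⟨w, hw, rfl⟩ := isLeft_neg.1 hu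
      exact (le_iff.1 h).2 _ (isRight_add.2 (.inr ⟨w, hw, rfl⟩)) (hx w hw.lt).1
    · exact (le_iff.1 h).2 _ (isRight_add.2 (.inl ⟨_, isRight_neg.2 ⟨w, hw, rfl⟩, rfl⟩))
        (hx w hw.lt).1
  · rw [le_iff]
    refine ⟨fun w hw _ => not_isLeft_zero hw, fun v hv h => ?_⟩
    rcases isRight_add.1 hv with ⟨u, hu, rfl⟩ | ⟨w, hw, rfl⟩
    · obtain ⟨w, hw, rfl⟩ := isRight_neg.1 hu
      exact (le_iff.1 h).1 _ (isLeft_add.2 (.inr ⟨w, hw, rfl⟩)) (hx w hw.lt).2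
    · exact (le_iff.1 h).1 _ (isLeft_add.2 (.inl ⟨_, isLeft_neg.2 ⟨w, hw, rfl⟩, rfl⟩))
        (hx w hw.lt).2
termination_by x.birthday

/-! ### Integers and dyadic rationals as games -/

/-- The game `0` for `0`, and `{n | }` for `n + 1`. -/
def ofNat : ℕ → ShortGame
  | 0 => 0
  | n + 1 => mk 1 0 (fun _ => ofNat n) Fin.elim0

/-- The canonical form of an integer. -/
def ofInt : ℤ → ShortGame
  | Int.ofNat n => ofNat n
  | Int.negSucc n => -ofNat (n + 1)

/-- The canonical form of `k / 2 ^ m`: for `k` odd and `m ≥ 1` it is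
`{(k - 1) / 2 ^ m | (k + 1) / 2 ^ m}`, with both options in canonical form. -/
def ofFrac : ℕ → ℤ → ShortGame
  | 0, k => ofInt k
  | m + 1, k =>
    if Even k then ofFrac m (k / 2)
    else mk 1 1 (fun _ => ofFrac m ((k - 1) / 2)) (fun _ => ofFrac m ((k + 1) / 2))

/-- The canonical form of a dyadic rational (whose reduced denominator is `2 ^ m`, so that `m` is
the base-two logarithm of the denominator). -/
def ofDyadic (q : DyadicRat) : ShortGame := ofFrac (Nat.log 2 (q : ℚ).den) (q : ℚ).num

/-! ### Temperature and cooling -/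

/-- The maximum of a nonempty finite family of dyadic rationals (`0` for the empty family, which
never matters: a game with no Left option is equal to an integer). -/
def familyMax {n : ℕ} (f : Fin n → DyadicRat) : DyadicRat :=
  if h : (Finset.univ : Finset (Fin n)).Nonempty then Finset.univ.sup' h f else 0

/-- The minimum of a nonempty finite family of dyadic rationals (`0` for the empty family, which
never matters: a game with no Right option is equal to an integer). -/
def familyMin {n : ℕ} (f : Fin n → DyadicRat) : DyadicRat :=
  if h : (Finset.univ : Finset (Fin n)).Nonempty then Finset.univ.inf' h f else 0

open Classical in
/-- The least element of a set of dyadic rationals, when it has one (`0` otherwise). -/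
noncomputable def leastOf (S : Set DyadicRat) : DyadicRat :=
  if h : ∃ a, IsLeast S a then h.choose else 0

/-- The data attached to a game `G`: the Left wall `t ↦ λ_t(G)`, the Right wall `t ↦ ρ_t(G)`, the
cooled games `t ↦ G_t`, and the temperature `t(G) ∈ ℤ[1/2] ∪ {-∞}`. -/
structure Thermal where
  leftWall : DyadicRat → DyadicRat
  rightWall : DyadicRat → DyadicRat
  cooled : DyadicRat → ShortGame
  temperature : WithBot DyadicRat

/-- `λ̃_t(G) = max (ρ_t(G^L) - t)`, from the data of the Left options. -/
def leftScaffold {m : ℕ} (TL : Fin m → Thermal) (t : DyadicRat) : DyadicRat :=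
  familyMax fun i => (TL i).rightWall t - t

/-- `ρ̃_t(G) = min (λ_t(G^R) + t)`, from the data of the Right options. -/
def rightScaffold {n : ℕ} (TR : Fin n → Thermal) (t : DyadicRat) : DyadicRat :=
  familyMin fun j => (TR j).leftWall t + t

/-- `G̃_t = {(G^L)_t - t | (G^R)_t + t}`, from the data of the options. -/
def cooledTilde {m n : ℕ} (TL : Fin m → Thermal) (TR : Fin n → Thermal) (t : DyadicRat) :
    ShortGame :=
  mk m n (fun i => (TL i).cooled t - ofDyadic t) (fun j => (TR j).cooled t + ofDyadic t)

/-- `min {t | λ̃_t(G) = ρ̃_t(G)}`, from the data of the options. -/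
noncomputable def freezingPoint {m n : ℕ} (TL : Fin m → Thermal) (TR : Fin n → Thermal) :
    DyadicRat :=
  leastOf {t | leftScaffold TL t = rightScaffold TR t}

open Classical in
/-- The walls, cooled games and temperature of a game, by recursion on the game. If `G` is equal to
an integer `n`, then everything is constantly `n` and the temperature is `-∞`. Otherwise the
temperature is the least `τ` with `λ̃_τ(G) = ρ̃_τ(G)`; the walls and the cooled game are
`λ̃_t`, `ρ̃_t`, `G̃_t` for `t ≤ τ`, and the number `x = λ̃_τ(G) = ρ̃_τ(G)` for `t > τ`. -/
noncomputable def thermal : ShortGame → Thermal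
  | mk m n L R =>
    if h : ∃ k : ℤ, mk m n L R ≈ ofInt k then
      { leftWall := fun _ => (h.choose : DyadicRat)
        rightWall := fun _ => (h.choose : DyadicRat)
        cooled := fun _ => ofInt h.choose
        temperature := ⊥ }
    else
      let TL := fun i => thermal (L i)
      let TR := fun j => thermal (R j)
      let τ := freezingPoint TL TR
      let x := leftScaffold TL τ
      { leftWall := fun t => if t ≤ τ then leftScaffold TL t else x
        rightWall := fun t => if t ≤ τ then rightScaffold TR t else x
        cooled := fun t => if t ≤ τ then cooledTilde TL TR t else ofDyadic x
        temperature := (τ : WithBot DyadicRat) }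

/-- The game `G_t`, that is, `G` cooled by `t`. -/
noncomputable def cool (t : DyadicRat) (G : ShortGame) : ShortGame := (thermal G).cooled t

end ShortGame

/-- The group of values of short normal-play games: games modulo equality, with the disjunctive
sum. -/
def GameValue : Type := Quotient ShortGame.setoid

namespace GameValue

/-- The value of a game. -/
def of (G : ShortGame) : GameValue := Quotient.mk ShortGame.setoid G

instance : Zero GameValue := ⟨of 0⟩

instance : Add GameValue :=
  ⟨Quotient.map₂ (· + ·) fun _ _ h _ _ h' =>
    ⟨ShortGame.add_le_add_game h.1 h'.1, ShortGame.add_le_add_game h.2 h'.2⟩⟩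

instance : Neg GameValue :=
  ⟨Quotient.map (- ·) fun _ _ h =>
    ⟨(ShortGame.neg_le_neg_iff _ _).2 h.2, (ShortGame.neg_le_neg_iff _ _).2 h.1⟩⟩

theorem add_comm' (x y : GameValue) : x + y = y + x := by
  induction x using Quotient.inductionOn
  induction y using Quotient.inductionOn
  exact Quotient.sound ⟨ShortGame.add_comm_le _ _, ShortGame.add_comm_le _ _⟩

theorem add_zero' (x : GameValue) : x + 0 = x := by
  induction x using Quotient.inductionOn
  exact Quotient.sound (ShortGame.add_zero_equiv _)

instance : AddCommGroup GameValue where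
  add_assoc x y z := by
    induction x using Quotient.inductionOn
    induction y using Quotient.inductionOn
    induction z using Quotient.inductionOn
    exact Quotient.sound (ShortGame.add_assoc_equiv _ _ _)
  zero_add x := (add_comm' _ _).trans (add_zero' x)
  add_zero := add_zero'
  add_comm := add_comm'
  neg_add_cancel x := by
    induction x using Quotient.inductionOn
    exact Quotient.sound (ShortGame.neg_add_equiv _)
  nsmul := nsmulRec
  zsmul := zsmulRec

end GameValue

/-! Everything reduces to one implication for three summands: if `t > -1` and `G + H + K ≥ 0`, then
`G_t + H_t + K_t ≥ 0`. Cooling commutes with negation (`of_cool_neg`), so the same holds for `≤`,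
hence for `=`. The triple `G, H, -(G + H)` then yields additivity, and for `G = H` the triple `G,
-H, 0` yields invariance under equality of values.

The implication is proved in `cool_sum`, by induction on the summands, together with a companion: if
Left wins `G + H + K` moving first, then she wins `G_t + H_t + K_t + t` moving first. The companion
holds because a Left option `x` of `G` satisfies `¬ G_t ≤ x_t - t`, even when `G` has frozen before
`t` (`not_cool_le_cool_sub`). For the main implication, Right's moves in unfrozen summands, each
costing him `t`, are handled by the companion. His moves in frozen summands are moves in numbers and
can be ignored while some summand is active: an active cooled game is `Unsettled`, this passes to
sums, and comparing an unsettled game with a number never requires a move in the number. If every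
summand has frozen, the claim is carried over from the largest freezing point.

All this presupposes that freezing points exist in `ℤ[1/2]` and exceed `-1` for non-integers.
Existence holds because walls are piecewise linear on a dyadic grid with slopes in `{-1, 0}` (Left)
and `{0, 1}` (Right), so a first crossing of scaffolds lies on the next finer grid. The bound holds
because at `-1` the walls record integer comparisons: scaffolds not strictly crossed there would
leave room for an integer between the options. -/

namespace GameValue

/-! ### The ordered group of game values -/

instance : PartialOrder GameValue where
  le := Quotient.lift₂ (· ≤ ·) fun _ _ _ _ h h' => propext
    ⟨fun H => h.2.trans (H.trans h'.1), fun H => h.1.trans (H.trans h'.2)⟩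
  le_refl x := by
    induction x using Quotient.inductionOn
    exact ShortGame.le_refl _
  le_trans x y z := by
    induction x using Quotient.inductionOn
    induction y using Quotient.inductionOn
    induction z using Quotient.inductionOn
    exact ShortGame.le_trans
  le_antisymm x y := by
    induction x using Quotient.inductionOn
    induction y using Quotient.inductionOn
    exact fun h h' => Quotient.sound ⟨h, h'⟩

theorem of_le_of {G H : ShortGame} : of G ≤ of H ↔ G ≤ H := Iff.rfl

theorem of_eq_of {G H : ShortGame} : of G = of H ↔ G ≈ H := Quotient.eq

theorem of_add (G H : ShortGame) : of (G + H) = of G + of H := rfl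

theorem of_neg (G : ShortGame) : of (-G) = -of G := rfl

theorem of_sub (G H : ShortGame) : of (G - H) = of G - of H := by
  rw [sub_eq_add_neg, ← of_neg, ← of_add]; rfl

theorem of_zero : of 0 = 0 := rfl

instance : IsOrderedAddMonoid GameValue where
  add_le_add_left x y h z := by
    induction x using Quotient.inductionOn
    induction y using Quotient.inductionOn
    induction z using Quotient.inductionOn
    exact ShortGame.add_le_add_right_game h _

end GameValue

namespace ShortGame

open GameValue

theorem IsLeft.not_le {x G : ShortGame} (h : IsLeft x G) : ¬ of G ≤ of x :=
  (le_iff.1 (ShortGame.le_refl G)).1 x h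

theorem IsRight.not_le {x G : ShortGame} (h : IsRight x G) : ¬ of x ≤ of G :=
  (le_iff.1 (ShortGame.le_refl G)).2 x h

/-! ### Canonical forms of dyadic rationals -/

theorem ofFrac_two_mul (m : ℕ) (k : ℤ) : ofFrac (m + 1) (2 * k) = ofFrac m k := by
  rw [ofFrac, if_pos (even_two_mul k)]
  simp

theorem ofFrac_odd (m : ℕ) (j : ℤ) :
    ofFrac (m + 1) (2 * j + 1) =
      mk 1 1 (fun _ => ofFrac m j) (fun _ => ofFrac m (j + 1)) := by
  rw [ofFrac, if_neg (by simp)]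
  congr 3 <;> · ext; congr 1; omega

theorem isRight_ofInt {x : ShortGame} {k : ℤ} :
    IsRight x (ofInt k) ↔ k < 0 ∧ x = ofInt (k + 1) := by
  match k with
  | Int.ofNat n =>
    have : ¬ (Int.ofNat n < 0) := by simp
    simp only [this, false_and, iff_false]
    cases n with
    | zero => exact not_isRight_zero
    | succ n => exact fun ⟨i, _⟩ => i.elim0
  | Int.negSucc n =>
    have h1 : ofInt (Int.negSucc n + 1) = -ofNat n := by
      cases n with
      | zero =>
        change (0 : ShortGame) = -(0 : ShortGame)
        change mk 0 0 _ _ = mk 0 0 _ _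
        congr 1 <;> exact funext fun i => i.elim0
      | succ n => rfl
    rw [h1]
    constructor
    · rintro ⟨i, rfl⟩
      exact ⟨Int.negSucc_lt_zero n, rfl⟩
    · rintro ⟨-, rfl⟩
      exact ⟨0, rfl⟩

theorem isLeft_ofInt {x : ShortGame} {k : ℤ} :
    IsLeft x (ofInt k) ↔ 0 < k ∧ x = ofInt (k - 1) := by
  match k with
  | Int.ofNat 0 => exact ⟨fun h => (not_isLeft_zero h).elim, fun h => (lt_irrefl _ h.1).elim⟩
  | Int.ofNat (n + 1) =>
    have h1 : ofInt (Int.ofNat (n + 1) - 1) = ofNat n := by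
      have : Int.ofNat (n + 1) - 1 = Int.ofNat n := by simp
      rw [this]; rfl
    rw [h1]
    constructor
    · rintro ⟨i, rfl⟩
      exact ⟨by simp, rfl⟩
    · rintro ⟨-, rfl⟩
      exact ⟨0, rfl⟩
  | Int.negSucc n =>
    have : ¬ (0 < Int.negSucc n) := by simp
    simp only [this, false_and, iff_false]
    exact fun ⟨i, _⟩ => i.elim0

theorem IsRight.ofFrac {m : ℕ} : ∀ {k : ℤ} {x : ShortGame}, IsRight x (ofFrac m k) →
    ∃ l, k < l ∧ x = ShortGame.ofFrac m l := by
  induction m with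
  | zero =>
    intro k x h
    obtain ⟨-, rfl⟩ := isRight_ofInt.1 h
    exact ⟨k + 1, by omega, rfl⟩
  | succ m ih =>
    intro k x h
    obtain ⟨j, rfl | rfl⟩ := Int.even_or_odd' k
    · rw [ofFrac_two_mul] at h
      obtain ⟨l, hl, rfl⟩ := ih h
      exact ⟨2 * l, by omega, (ofFrac_two_mul m l).symm⟩
    · rw [ofFrac_odd] at h
      obtain ⟨i, rfl⟩ := h
      exact ⟨2 * (j + 1), by omega, (ofFrac_two_mul m _).symm⟩

theorem IsLeft.ofFrac {m : ℕ} : ∀ {k : ℤ} {x : ShortGame}, IsLeft x (ofFrac m k) →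
    ∃ l, l < k ∧ x = ShortGame.ofFrac m l := by
  induction m with
  | zero =>
    intro k x h
    obtain ⟨-, rfl⟩ := isLeft_ofInt.1 h
    exact ⟨k - 1, by omega, rfl⟩
  | succ m ih =>
    intro k x h
    obtain ⟨j, rfl | rfl⟩ := Int.even_or_odd' k
    · rw [ofFrac_two_mul] at h
      obtain ⟨l, hl, rfl⟩ := ih h
      exact ⟨2 * l, by omega, (ofFrac_two_mul m l).symm⟩
    · rw [ofFrac_odd] at h
      obtain ⟨i, rfl⟩ := h
      exact ⟨2 * j, by omega, (ofFrac_two_mul m _).symm⟩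

theorem isRight_ofFrac_odd (m : ℕ) {k : ℤ} (hk : Odd k) :
    IsRight (ofFrac (m + 1) (k + 1)) (ofFrac (m + 1) k) := by
  obtain ⟨j, rfl⟩ := hk
  rw [ofFrac_odd, show 2 * j + 1 + 1 = 2 * (j + 1) by ring, ofFrac_two_mul]
  exact ⟨0, rfl⟩

theorem isLeft_ofFrac_odd (m : ℕ) {k : ℤ} (hk : Odd k) :
    IsLeft (ofFrac (m + 1) (k - 1)) (ofFrac (m + 1) k) := by
  obtain ⟨j, rfl⟩ := hk
  rw [ofFrac_odd, show 2 * j + 1 - 1 = 2 * j by ring, ofFrac_two_mul]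
  exact ⟨0, rfl⟩

/-- With the denominator fixed, every option moves the numerator strictly in the expected direction,
which gives the weak half. For the strict half, an option with numerator `k + 1` or `l - 1` would
refute the inequality. If neither is available, then for `m = 0` the signs give `l ≤ 0 ≤ k`, and
otherwise both numerators are even and the denominator halves. The games do not change in that step,
hence the lexicographic measure. -/
theorem ofFrac_order (m : ℕ) (k l : ℤ) :
    (k ≤ l → ofFrac m k ≤ ofFrac m l) ∧ (k < l → ¬ ofFrac m l ≤ ofFrac m k) := by
  refine ⟨fun hkl => le_iff.2 ⟨fun z hz => ?_, fun z hz => ?_⟩, fun hkl h => ?_⟩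
  · have := hz.lt
    obtain ⟨k', hk', rfl⟩ := hz.ofFrac
    exact (ofFrac_order m k' l).2 (by omega)
  · have := hz.lt
    obtain ⟨l', hl', rfl⟩ := hz.ofFrac
    exact (ofFrac_order m k l').2 (by omega)
  · have hR : ¬ IsRight (ofFrac m (k + 1)) (ofFrac m k) := fun hz => by
      have := hz.lt
      exact (le_iff.1 h).2 _ hz ((ofFrac_order m (k + 1) l).1 (by omega))
    have hL : ¬ IsLeft (ofFrac m (l - 1)) (ofFrac m l) := fun hz => by
      have := hz.lt
      exact (le_iff.1 h).1 _ hz ((ofFrac_order m k (l - 1)).1 (by omega))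
    match m, h, hR, hL with
    | 0, h, hR, hL =>
      have h1 : ¬ k < 0 := fun h0 => hR (isRight_ofInt.2 ⟨h0, rfl⟩)
      have h2 : ¬ 0 < l := fun h0 => hL (isLeft_ofInt.2 ⟨h0, rfl⟩)
      omega
    | m + 1, h, hR, hL =>
      obtain ⟨i, rfl⟩ := (Int.not_odd_iff_even.1 fun ho => hR (isRight_ofFrac_odd m ho)).two_dvd
      obtain ⟨j, rfl⟩ := (Int.not_odd_iff_even.1 fun ho => hL (isLeft_ofFrac_odd m ho)).two_dvd
      rw [ofFrac_two_mul, ofFrac_two_mul] at h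
      exact (ofFrac_order m i j).2 (by omega) h
termination_by (m, (ofFrac m k).birthday + (ofFrac m l).birthday)

/-- The descent of `ofFrac_order` with two summands on one side: either a unit step in some
component decides the comparison, or all three numerators can be halved. -/
theorem ofFrac_add_order (m : ℕ) (k l r : ℤ) :
    (k + l ≤ r → ofFrac m k + ofFrac m l ≤ ofFrac m r) ∧
      (k + l < r → ¬ ofFrac m r ≤ ofFrac m k + ofFrac m l) := by
  refine ⟨fun hr => le_iff.2 ⟨fun z hz => ?_, fun z hz => ?_⟩, fun hr h => ?_⟩
  · rcases isLeft_add.1 hz with ⟨w, hw, rfl⟩ | ⟨w, hw, rfl⟩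
    · have := hw.lt
      obtain ⟨k', hk', rfl⟩ := hw.ofFrac
      exact (ofFrac_add_order m k' l r).2 (by omega)
    · have := hw.lt
      obtain ⟨l', hl', rfl⟩ := hw.ofFrac
      exact (ofFrac_add_order m k l' r).2 (by omega)
  · have := hz.lt
    obtain ⟨s, hs, rfl⟩ := hz.ofFrac
    exact (ofFrac_add_order m k l s).2 (by omega)
  · have hk : ¬ IsRight (ofFrac m (k + 1)) (ofFrac m k) := fun hw => by
      have := hw.lt
      exact (le_iff.1 h).2 _ (isRight_add.2 (.inl ⟨_, hw, rfl⟩))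
        ((ofFrac_add_order m (k + 1) l r).1 (by omega))
    have hl : ¬ IsRight (ofFrac m (l + 1)) (ofFrac m l) := fun hw => by
      have := hw.lt
      exact (le_iff.1 h).2 _ (isRight_add.2 (.inr ⟨_, hw, rfl⟩))
        ((ofFrac_add_order m k (l + 1) r).1 (by omega))
    have hr' : ¬ IsLeft (ofFrac m (r - 1)) (ofFrac m r) := fun hw => by
      have := hw.lt
      exact (le_iff.1 h).1 _ hw ((ofFrac_add_order m k l (r - 1)).1 (by omega))
    match m, h, hk, hl, hr' with
    | 0, h, hk, hl, hr' =>
      have h1 : ¬ k < 0 := fun h0 => hk (isRight_ofInt.2 ⟨h0, rfl⟩)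
      have h2 : ¬ l < 0 := fun h0 => hl (isRight_ofInt.2 ⟨h0, rfl⟩)
      have h3 : ¬ 0 < r := fun h0 => hr' (isLeft_ofInt.2 ⟨h0, rfl⟩)
      omega
    | m + 1, h, hk, hl, hr' =>
      obtain ⟨i, rfl⟩ := (Int.not_odd_iff_even.1 fun ho => hk (isRight_ofFrac_odd m ho)).two_dvd
      obtain ⟨j, rfl⟩ := (Int.not_odd_iff_even.1 fun ho => hl (isRight_ofFrac_odd m ho)).two_dvd
      obtain ⟨u, rfl⟩ := (Int.not_odd_iff_even.1 fun ho => hr' (isLeft_ofFrac_odd m ho)).two_dvd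
      rw [ofFrac_two_mul, ofFrac_two_mul, ofFrac_two_mul] at h
      exact (ofFrac_add_order m i j u).2 (by omega) h
termination_by (m, (ofFrac m k).birthday + (ofFrac m l).birthday + (ofFrac m r).birthday)

theorem ofFrac_order_add (m : ℕ) (k l r : ℤ) :
    (r ≤ k + l → ofFrac m r ≤ ofFrac m k + ofFrac m l) ∧
      (r < k + l → ¬ ofFrac m k + ofFrac m l ≤ ofFrac m r) := by
  refine ⟨fun hr => le_iff.2 ⟨fun z hz => ?_, fun z hz => ?_⟩, fun hr h => ?_⟩
  · have := hz.lt
    obtain ⟨s, hs, rfl⟩ := hz.ofFrac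
    exact (ofFrac_order_add m k l s).2 (by omega)
  · rcases isRight_add.1 hz with ⟨w, hw, rfl⟩ | ⟨w, hw, rfl⟩
    · have := hw.lt
      obtain ⟨k', hk', rfl⟩ := hw.ofFrac
      exact (ofFrac_order_add m k' l r).2 (by omega)
    · have := hw.lt
      obtain ⟨l', hl', rfl⟩ := hw.ofFrac
      exact (ofFrac_order_add m k l' r).2 (by omega)
  · have hk : ¬ IsLeft (ofFrac m (k - 1)) (ofFrac m k) := fun hw => by
      have := hw.lt
      exact (le_iff.1 h).1 _ (isLeft_add.2 (.inl ⟨_, hw, rfl⟩))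
        ((ofFrac_order_add m (k - 1) l r).1 (by omega))
    have hl : ¬ IsLeft (ofFrac m (l - 1)) (ofFrac m l) := fun hw => by
      have := hw.lt
      exact (le_iff.1 h).1 _ (isLeft_add.2 (.inr ⟨_, hw, rfl⟩))
        ((ofFrac_order_add m k (l - 1) r).1 (by omega))
    have hr' : ¬ IsRight (ofFrac m (r + 1)) (ofFrac m r) := fun hw => by
      have := hw.lt
      exact (le_iff.1 h).2 _ hw ((ofFrac_order_add m k l (r + 1)).1 (by omega))
    match m, h, hk, hl, hr' with
    | 0, h, hk, hl, hr' =>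
      have h1 : ¬ 0 < k := fun h0 => hk (isLeft_ofInt.2 ⟨h0, rfl⟩)
      have h2 : ¬ 0 < l := fun h0 => hl (isLeft_ofInt.2 ⟨h0, rfl⟩)
      have h3 : ¬ r < 0 := fun h0 => hr' (isRight_ofInt.2 ⟨h0, rfl⟩)
      omega
    | m + 1, h, hk, hl, hr' =>
      obtain ⟨i, rfl⟩ := (Int.not_odd_iff_even.1 fun ho => hk (isLeft_ofFrac_odd m ho)).two_dvd
      obtain ⟨j, rfl⟩ := (Int.not_odd_iff_even.1 fun ho => hl (isLeft_ofFrac_odd m ho)).two_dvd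
      obtain ⟨u, rfl⟩ := (Int.not_odd_iff_even.1 fun ho => hr' (isRight_ofFrac_odd m ho)).two_dvd
      rw [ofFrac_two_mul, ofFrac_two_mul, ofFrac_two_mul] at h
      exact (ofFrac_order_add m i j u).2 (by omega) h
termination_by (m, (ofFrac m k).birthday + (ofFrac m l).birthday + (ofFrac m r).birthday)

/-- The fraction need not be reduced, so several dyadic numbers can be treated over one common
denominator. -/
theorem ofDyadic_eq_ofFrac {q : DyadicRat} (m : ℕ) : ∀ k : ℤ, (q : ℚ) = k / 2 ^ m →
    ofDyadic q = ofFrac m k := by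
  induction m with
  | zero =>
    intro k h
    have h : (q : ℚ) = k := by simpa using h
    simp [ofDyadic, h]
  | succ m ih =>
    intro k h
    rcases Int.even_or_odd k with hk | hk
    · obtain ⟨j, rfl⟩ := hk.two_dvd
      rw [ofFrac_two_mul]
      refine ih j (h.trans ?_)
      rw [pow_succ]; push_cast; field_simp
    · have hc : Nat.Coprime k.natAbs ((2 : ℤ) ^ (m + 1)).natAbs := by
        rw [Int.natAbs_pow]
        exact (Nat.coprime_two_right.2 (Int.natAbs_odd.2 hk)).pow_right _
      have h : (q : ℚ) = (k : ℚ) / ((2 ^ (m + 1) : ℤ) : ℚ) := by push_cast; exact h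
      have hn := Rat.num_div_eq_of_coprime (by positivity) hc
      have hd := Rat.den_div_eq_of_coprime (by positivity) hc
      rw [← h] at hn hd
      have hd : (q : ℚ).den = 2 ^ (m + 1) := by exact_mod_cast hd
      rw [ofDyadic, hn, hd, Nat.log_pow (by norm_num)]

/-- The value of a dyadic rational. -/
def number (q : DyadicRat) : GameValue := of (ofDyadic q)

theorem exists_common_denominator (p q r : DyadicRat) :
    ∃ (m : ℕ) (i j k : ℤ), (p : ℚ) = i / 2 ^ m ∧ (q : ℚ) = j / 2 ^ m ∧ (r : ℚ) = k / 2 ^ m := by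
  obtain ⟨_, i, a, rfl⟩ := p
  obtain ⟨_, j, b, rfl⟩ := q
  obtain ⟨_, k, c, rfl⟩ := r
  refine ⟨a + b + c, i * 2 ^ (b + c), j * 2 ^ (a + c), k * 2 ^ (a + b), ?_, ?_, ?_⟩ <;>
  · push_cast
    field_simp
    ring

theorem number_le_number {p q : DyadicRat} : number p ≤ number q ↔ p ≤ q := by
  obtain ⟨m, i, j, -, hp, hq, -⟩ := exists_common_denominator p q 0
  have hij : p ≤ q ↔ i ≤ j := by
    rw [← Subtype.coe_le_coe, hp, hq, div_le_div_iff_of_pos_right (by positivity), Int.cast_le]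
  rw [hij, number, number, of_le_of, ofDyadic_eq_ofFrac m i hp, ofDyadic_eq_ofFrac m j hq]
  exact ⟨fun h => not_lt.1 fun h' => (ofFrac_order m j i).2 h' h, (ofFrac_order m i j).1⟩

theorem number_add (p q : DyadicRat) : number (p + q) = number p + number q := by
  obtain ⟨m, i, j, k, hp, hq, hr⟩ := exists_common_denominator p q (p + q)
  have hk : k = i + j := by
    have h : (k : ℚ) / 2 ^ m = ((i + j : ℤ) : ℚ) / 2 ^ m := by
      rw [← hr, Subring.coe_add, hp, hq]; push_cast; ring
    rwa [div_left_inj' (by positivity), Int.cast_inj] at h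
  rw [number, number, number, ← of_add, of_eq_of, ofDyadic_eq_ofFrac m i hp,
    ofDyadic_eq_ofFrac m j hq, ofDyadic_eq_ofFrac m k hr]
  exact ⟨(ofFrac_order_add m i j k).1 hk.le, (ofFrac_add_order m i j k).1 hk.ge⟩

theorem number_zero : number 0 = 0 := by
  have h := number_add 0 0
  rwa [add_zero, left_eq_add] at h

theorem number_neg (p : DyadicRat) : number (-p) = -number p := by
  rw [eq_neg_iff_add_eq_zero, ← number_add, neg_add_cancel, number_zero]

theorem number_sub (p q : DyadicRat) : number (p - q) = number p - number q := by
  rw [sub_eq_add_neg, number_add, number_neg, sub_eq_add_neg]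

theorem number_intCast (k : ℤ) : number k = of (ofInt k) := by
  rw [number, ofDyadic_eq_ofFrac 0 k (by simp), ofFrac]

theorem of_ofInt_le {j k : ℤ} : of (ofInt j) ≤ of (ofInt k) ↔ j ≤ k := by
  rw [← number_intCast, ← number_intCast, number_le_number, Int.cast_le]

theorem IsRight.of_ofDyadic {q : DyadicRat} {x : ShortGame} (h : IsRight x (ofDyadic q)) :
    ∃ z, q < z ∧ of x = number z := by
  obtain ⟨_, k, m, rfl⟩ := q
  rw [ofDyadic_eq_ofFrac m k rfl] at h
  obtain ⟨l, hl, rfl⟩ := h.ofFrac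
  refine ⟨⟨_, l, m, rfl⟩, ?_, ?_⟩
  · rw [← Subtype.coe_lt_coe]
    exact (div_lt_div_iff_of_pos_right (by positivity)).2 (Int.cast_lt.2 hl)
  · rw [number, ofDyadic_eq_ofFrac m l rfl]

theorem IsLeft.of_ofDyadic {q : DyadicRat} {x : ShortGame} (h : IsLeft x (ofDyadic q)) :
    ∃ z, z < q ∧ of x = number z := by
  obtain ⟨_, k, m, rfl⟩ := q
  rw [ofDyadic_eq_ofFrac m k rfl] at h
  obtain ⟨l, hl, rfl⟩ := h.ofFrac
  refine ⟨⟨_, l, m, rfl⟩, ?_, ?_⟩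
  · rw [← Subtype.coe_lt_coe]
    exact (div_lt_div_iff_of_pos_right (by positivity)).2 (Int.cast_lt.2 hl)
  · rw [number, ofDyadic_eq_ofFrac m l rfl]

theorem le_ofNat_birthday (G : ShortGame) (n : ℕ) (h : G.birthday ≤ n) : G ≤ ofInt n := by
  refine le_iff.2 ⟨fun z hz hle => ?_, fun z hz => ?_⟩
  · have := hz.lt
    obtain ⟨k, rfl⟩ : ∃ k, n = k + 1 := ⟨n - 1, by omega⟩
    have h1 := of_ofInt_le.1 (of_le_of.2 (hle.trans (le_ofNat_birthday z k (by omega))))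
    omega
  · have := (isRight_ofInt.1 hz).1
    omega
termination_by n

theorem neg_ofNat_birthday_le (G : ShortGame) (n : ℕ) (h : G.birthday ≤ n) :
    ofInt (-n) ≤ G := by
  refine le_iff.2 ⟨fun z hz => ?_, fun z hz hle => ?_⟩
  · have := (isLeft_ofInt.1 hz).1
    omega
  · have := hz.lt
    obtain ⟨k, rfl⟩ : ∃ k, n = k + 1 := ⟨n - 1, by omega⟩
    have h1 := of_ofInt_le.1 (of_le_of.2 ((neg_ofNat_birthday_le z k (by omega)).trans hle))
    omega
termination_by n

theorem exists_le_number (G : ShortGame) : ∃ q, of G ≤ number q :=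
  ⟨((G.birthday : ℤ) : DyadicRat), by
    rw [number_intCast]; exact le_ofNat_birthday G _ le_rfl⟩

theorem exists_number_le (G : ShortGame) : ∃ q, number q ≤ of G :=
  ⟨((-G.birthday : ℤ) : DyadicRat), by
    rw [number_intCast]; exact neg_ofNat_birthday_le G _ le_rfl⟩

/-! ### Games equal to an integer -/

/-- `G` is equal to an integer. -/
def IsInt (G : ShortGame) : Prop := ∃ k : ℤ, G ≈ ofInt k

/-- If some integer lies strictly between the Left and the Right options, then the game is an
integer. -/
theorem isInt_of_fits {G : ShortGame} (n : ℤ) (hL : ∀ x, IsLeft x G → ¬ ofInt n ≤ x)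
    (hR : ∀ x, IsRight x G → ¬ x ≤ ofInt n) : IsInt G := by
  induction hn : n.natAbs using Nat.strong_induction_on generalizing n with
  | _ a ih =>
  subst hn
  by_contra hG
  have key : ¬ (G ≤ ofInt n ∧ ofInt n ≤ G) := fun h => hG ⟨n, h⟩
  rcases not_and_or.1 key with h | h
  · rcases not_le_iff.1 h with ⟨z, hz, hle⟩ | ⟨z, hz, hle⟩
    · exact hL z hz hle
    · obtain ⟨hn, rfl⟩ := isRight_ofInt.1 hz
      -- The failed comparison says that an option of `n`, an integer closer to zero, lies below
      -- `G`. That integer fits between the options too, so the induction on `|n|` applies.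
      refine hG (ih _ (by omega) (n + 1) (fun x hx hle' => hL x hx ?_) (fun x hx hle' => ?_) rfl)
      · exact (of_le_of.1 (of_ofInt_le.2 (by omega))).trans hle'
      · exact hx.not_le (hle'.trans hle)
  · rcases not_le_iff.1 h with ⟨z, hz, hle⟩ | ⟨z, hz, hle⟩
    · obtain ⟨hn, rfl⟩ := isLeft_ofInt.1 hz
      refine hG (ih _ (by omega) (n - 1) (fun x hx hle' => ?_) (fun x hx hle' => hR x hx ?_) rfl)
      · exact hx.not_le (hle.trans hle')
      · exact hle'.trans (of_le_of.1 (of_ofInt_le.2 (by omega)))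
    · exact hR z hz hle

/-- With no Left options, any integer below all Right options fits. Hence the default value of
`familyMax` is never met. -/
theorem exists_isLeft_of_not_isInt {G : ShortGame} (hG : ¬ IsInt G) : ∃ x, IsLeft x G := by
  by_contra! h
  refine hG (isInt_of_fits (-(G.birthday : ℤ) - 1) (fun x hx => (h x hx).elim) fun x hx hle => ?_)
  have := of_ofInt_le.1 (of_le_of.2 ((neg_ofNat_birthday_le x _ hx.lt.le).trans hle))
  omega

theorem exists_isRight_of_not_isInt {G : ShortGame} (hG : ¬ IsInt G) : ∃ x, IsRight x G := by
  by_contra! h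
  refine hG (isInt_of_fits ((G.birthday : ℤ) + 1) (fun x hx hle => ?_) fun x hx => (h x hx).elim)
  have := of_ofInt_le.1 (of_le_of.2 (hle.trans (le_ofNat_birthday x _ hx.lt.le)))
  omega

end ShortGame

/-! ### Piecewise linear functions on a dyadic grid -/

/-- On every cell `[k / 2 ^ N, (k + 1) / 2 ^ N]` the function `f` is affine of slope `c` or
`c + 1`, and its values at the grid points are multiples of `1 / 2 ^ N`. -/
def GridLinear (N : ℕ) (c : ℤ) (f : DyadicRat → DyadicRat) : Prop :=
  ∀ k : ℤ, ∃ a e : ℤ, (e = c ∨ e = c + 1) ∧ ∀ t : DyadicRat, (k : DyadicRat) ≤ 2 ^ N * t →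
    2 ^ N * t ≤ k + 1 → 2 ^ N * f t = a + e * (2 ^ N * t - k)

namespace GridLinear

variable {N : ℕ} {c : ℤ} {f g : DyadicRat → DyadicRat}

theorem const (N : ℕ) {c : ℤ} (hc : c = 0 ∨ c = -1) (n : ℤ) :
    GridLinear N c fun _ => (n : DyadicRat) :=
  fun k => ⟨2 ^ N * n, 0, by omega, fun t _ _ => by push_cast; ring⟩

theorem succ (hf : GridLinear N c f) : GridLinear (N + 1) c f := by
  intro k
  obtain ⟨j, hj⟩ := Int.even_or_odd' k
  obtain ⟨a, e, he, h⟩ := hf j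
  have key : ∀ b : ℤ, (b = 0 ∨ b = 1) → k = 2 * j + b → ∃ a e : ℤ, (e = c ∨ e = c + 1) ∧
      ∀ t : DyadicRat, (k : DyadicRat) ≤ 2 ^ (N + 1) * t → 2 ^ (N + 1) * t ≤ k + 1 →
        2 ^ (N + 1) * f t = a + e * (2 ^ (N + 1) * t - k) := by
    intro b hb hk
    refine ⟨2 * a + e * b, e, he, fun t h1 h2 => ?_⟩
    have hb0 : (0 : DyadicRat) ≤ b ∧ (b : DyadicRat) ≤ 1 := by
      rcases hb with rfl | rfl <;> norm_num
    have hk' : (k : DyadicRat) = 2 * j + b := by rw [hk]; push_cast; ring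
    rw [pow_succ] at h1 h2 ⊢
    have := h t (by linarith) (by linarith)
    rw [hk']
    push_cast
    linear_combination 2 * this
  rcases hj with hj | hj
  · exact key 0 (by simp) (by omega)
  · exact key 1 (by simp) (by omega)

theorem mono {M : ℕ} (hf : GridLinear N c f) (h : N ≤ M) : GridLinear M c f := by
  induction M, h using Nat.le_induction with
  | base => exact hf
  | succ M _ ih => exact ih.succ

theorem neg (hf : GridLinear N c f) : GridLinear N (-c - 1) fun t => -f t := by
  intro k
  obtain ⟨a, e, he, h⟩ := hf k
  refine ⟨-a, -e, by omega, fun t h1 h2 => ?_⟩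
  push_cast
  linear_combination -h t h1 h2

theorem add_id (hf : GridLinear N c f) : GridLinear N (c + 1) fun t => f t + t := by
  intro k
  obtain ⟨a, e, he, h⟩ := hf k
  refine ⟨a + k, e + 1, by omega, fun t h1 h2 => ?_⟩
  push_cast
  linear_combination h t h1 h2

theorem sub_id (hf : GridLinear N c f) : GridLinear N (c - 1) fun t => f t - t := by
  intro k
  obtain ⟨a, e, he, h⟩ := hf k
  refine ⟨a - k, e - 1, by omega, fun t h1 h2 => ?_⟩
  push_cast
  linear_combination h t h1 h2

/-- Within a cell one of the two functions dominates throughout: distinct rescaled values at the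
left endpoint are integers at least `1` apart, and slopes differ by at most `1`, so the lines cannot
cross before the right endpoint. In case of a tie the larger slope wins. -/
theorem sup (hf : GridLinear N c f) (hg : GridLinear N c g) :
    GridLinear N c fun t => f t ⊔ g t := by
  intro k
  obtain ⟨a, e, he, h⟩ := hf k
  obtain ⟨b, d, hd, h'⟩ := hg k
  have hpos : (0 : DyadicRat) < 2 ^ N := by positivity
  by_cases hab : a < b ∨ (a = b ∧ e ≤ d)
  · refine ⟨b, d, hd, fun t h1 h2 => ?_⟩
    dsimp only
    rw [sup_eq_right.2, h' t h1 h2]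
    refine le_of_mul_le_mul_left ?_ hpos
    rw [h t h1 h2, h' t h1 h2]
    rcases hab with hab | ⟨rfl, hed⟩
    · have h3 : (a : DyadicRat) + 1 ≤ b := by exact_mod_cast hab
      have h4 : (e : DyadicRat) ≤ d + 1 := by exact_mod_cast (by omega : e ≤ d + 1)
      nlinarith
    · have h4 : (e : DyadicRat) ≤ d := by exact_mod_cast hed
      nlinarith
  · refine ⟨a, e, he, fun t h1 h2 => ?_⟩
    dsimp only
    rw [sup_eq_left.2, h t h1 h2]
    refine le_of_mul_le_mul_left ?_ hpos
    rw [h t h1 h2, h' t h1 h2]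
    have h5 : b < a ∨ (a = b ∧ d ≤ e) := by omega
    rcases h5 with hab | ⟨rfl, hed⟩
    · have h3 : (b : DyadicRat) + 1 ≤ a := by exact_mod_cast hab
      have h4 : (d : DyadicRat) ≤ e + 1 := by exact_mod_cast (by omega : d ≤ e + 1)
      nlinarith
    · have h4 : (d : DyadicRat) ≤ e := by exact_mod_cast hed
      nlinarith

theorem inf (hf : GridLinear N c f) (hg : GridLinear N c g) :
    GridLinear N c fun t => f t ⊓ g t := by
  have h := (hf.neg.sup hg.neg).neg
  simp only [← neg_inf, neg_neg] at h
  convert h using 1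
  ring

/-- Freezing a grid-linear function from a grid point on. -/
theorem freeze (hc : c = 0 ∨ c = -1) (hf : GridLinear N c f) {τ : DyadicRat} {K : ℤ}
    (hτ : 2 ^ N * τ = K) : GridLinear N c fun t => if t ≤ τ then f t else f τ := by
  have hpos : (0 : DyadicRat) < 2 ^ N := by positivity
  intro k
  rcases lt_or_ge k K with hk | hk
  · obtain ⟨a, e, he, h⟩ := hf k
    refine ⟨a, e, he, fun t h1 h2 => ?_⟩
    have h3 : (k : DyadicRat) + 1 ≤ K := by exact_mod_cast hk
    dsimp only
    rw [if_pos (le_of_mul_le_mul_left (by linarith) hpos), h t h1 h2]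
  · obtain ⟨a, e, he, h⟩ := hf K
    have h0 := h τ hτ.ge (by rw [hτ]; linarith)
    -- The frozen part has slope `0`, which is admissible exactly because `c` is `0` or `-1`.
    refine ⟨a, 0, by omega, fun t h1 h2 => ?_⟩
    have h3 : (K : DyadicRat) ≤ k := by exact_mod_cast hk
    have h4 : (if t ≤ τ then f t else f τ) = f τ := by
      split_ifs with h5
      · rw [le_antisymm h5 (le_of_mul_le_mul_left (by linarith) hpos)]
      · rfl
    dsimp only
    rw [h4, h0, hτ]
    push_cast
    ring

end GridLinear

/-- One half, as a dyadic rational. -/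
def dyadicHalf : DyadicRat := ⟨1 / 2, 1, 1, by norm_num⟩

theorem two_mul_dyadicHalf : 2 * dyadicHalf = 1 := by
  apply Subtype.ext
  change (2 : ℚ) * (1 / 2) = 1
  norm_num

theorem two_pow_mul_dyadicHalf_pow (N : ℕ) : (2 : DyadicRat) ^ N * dyadicHalf ^ N = 1 := by
  rw [← mul_pow, two_mul_dyadicHalf, one_pow]

theorem exists_int_ge_dyadic (q : DyadicRat) : ∃ n : ℤ, q ≤ n := by
  obtain ⟨n, hn⟩ := exists_int_ge (q : ℚ)
  exact ⟨n, by rw [← Subtype.coe_le_coe]; simpa using hn⟩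

/-- A decreasing and an increasing grid-linear function that cross do so for a first time, at a
point of the next finer grid. -/
theorem GridLinear.exists_first_crossing {N : ℕ} {f g : DyadicRat → DyadicRat}
    (hf : GridLinear N (-1) f) (hg : GridLinear N 0 g) (hf' : Antitone f) (hg' : Monotone g)
    (h0 : g (-1) < f (-1)) {T : DyadicRat} (hT : f T ≤ g T) :
    ∃ (τ : DyadicRat) (K : ℤ), 2 ^ (N + 1) * τ = K ∧ f τ = g τ ∧ ∀ t < τ, g t < f t := by
  have hpos : (0 : DyadicRat) < 2 ^ N := by positivity
  set h : DyadicRat := dyadicHalf ^ N with hh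
  have h1 : 2 ^ N * h = 1 := two_pow_mul_dyadicHalf_pow N
  have hh0 : 0 < h := pos_of_mul_pos_right (by rw [h1]; exact one_pos) hpos.le
  -- The first grid point at which the functions have crossed. By monotonicity none lies at or to
  -- the left of `-1`, and every grid point to the right of `T` qualifies.
  obtain ⟨k, hk, hmin⟩ := Int.exists_least_of_bdd (P := fun k : ℤ => f (k * h) ≤ g (k * h))
    ⟨-2 ^ N, fun z hz => by
      by_contra hlt
      have hz1 : (z : DyadicRat) ≤ ((-2 ^ N : ℤ) : DyadicRat) := Int.cast_le.2 (not_le.1 hlt).le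
      push_cast at hz1
      have hz2 : (z : DyadicRat) * h ≤ -1 := by nlinarith
      exact absurd (hz.trans (hg' hz2)) (not_le.2 (h0.trans_le (hf' hz2)))⟩
    (by
      obtain ⟨n, hn⟩ := exists_int_ge_dyadic (2 ^ N * T)
      have hT' : T ≤ n * h := by
        have := mul_le_mul_of_nonneg_right hn hh0.le
        linear_combination this - T * h1
      exact ⟨n, (hf' hT').trans (hT.trans (hg' hT'))⟩)
  have hlt : g ((k - 1 : ℤ) * h) < f ((k - 1 : ℤ) * h) := by
    by_contra hle
    have := hmin (k - 1) (not_lt.1 hle)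
    omega
  obtain ⟨a, e, he, hfa⟩ := hf (k - 1)
  obtain ⟨b, d, hd, hgb⟩ := hg (k - 1)
  have hu : ∀ u : DyadicRat, 2 ^ N * (u * h) = u := fun u => by linear_combination u * h1
  have hab : b < a := by
    have e1 := hfa ((k - 1 : ℤ) * h) (by rw [hu]) (by rw [hu]; linarith)
    have e2 := hgb ((k - 1 : ℤ) * h) (by rw [hu]) (by rw [hu]; linarith)
    rw [hu, sub_self, mul_zero, add_zero] at e1 e2
    have := mul_lt_mul_of_pos_left hlt hpos
    rw [e1, e2] at this
    exact_mod_cast this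
  have hab' : a + e ≤ b + d := by
    have e1 := hfa (k * h) (by rw [hu]; push_cast; linarith) (by rw [hu]; push_cast; linarith)
    have e2 := hgb (k * h) (by rw [hu]; push_cast; linarith) (by rw [hu]; push_cast; linarith)
    rw [hu] at e1 e2
    have := mul_le_mul_of_nonneg_left hk hpos.le
    rw [e1, e2] at this
    push_cast at this
    have h3 : ((a + e : ℤ) : DyadicRat) ≤ ((b + d : ℤ) : DyadicRat) := by push_cast; linarith
    exact_mod_cast h3
  -- In the cell ending at `k * h` the gap falls from `a - b ≥ 1` at the rate `d - e ≤ 2`, and it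
  -- closes by the end of the cell. The meeting point is the fraction `(a - b) / (d - e)` of the
  -- cell, either `1` or `1/2`.
  obtain ⟨u, U, hU, hu0, hu1, hzero⟩ : ∃ (u : DyadicRat) (U : ℤ), 2 * u = U ∧ 0 < u ∧ u ≤ 1 ∧
      (a - b : DyadicRat) = (d - e) * u := by
    have hhalf := two_mul_dyadicHalf
    have hcases : (a - b = d - e) ∨ (a - b = 1 ∧ d - e = 2) := by omega
    rcases hcases with h3 | ⟨h3, h4⟩
    · refine ⟨1, 2, by norm_num, one_pos, le_rfl, ?_⟩
      rw [mul_one]; exact_mod_cast h3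
    · refine ⟨dyadicHalf, 1, by rw [hhalf]; norm_num, by linarith, by linarith, ?_⟩
      have h3' : (a - b : DyadicRat) = 1 := by exact_mod_cast h3
      have h4' : (d - e : DyadicRat) = 2 := by exact_mod_cast h4
      rw [h3', h4', hhalf]
  have hde : (0 : DyadicRat) < d - e := by
    have : (0 : ℤ) < d - e := by omega
    exact_mod_cast this
  refine ⟨((k - 1 : ℤ) + u) * h, 2 * (k - 1) + U, ?_, ?_, fun t ht => ?_⟩
  · rw [pow_succ]
    push_cast
    linear_combination 2 * ((k - 1 : DyadicRat) + u) * h1 + hU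
  · have e1 := hfa (((k - 1 : ℤ) + u) * h) (by rw [hu]; linarith) (by rw [hu]; linarith)
    have e2 := hgb (((k - 1 : ℤ) + u) * h) (by rw [hu]; linarith) (by rw [hu]; linarith)
    refine mul_left_cancel₀ hpos.ne' ?_
    rw [e1, e2, hu]
    linear_combination hzero
  · rcases le_total t ((k - 1 : ℤ) * h) with h5 | h5
    · exact (hg' h5).trans_lt (hlt.trans_le (hf' h5))
    · have h6 := mul_lt_mul_of_pos_left ht hpos
      have h7 := mul_le_mul_of_nonneg_left h5 hpos.le
      rw [hu] at h6 h7
      have e1 := hfa t h7 (by linarith)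
      have e2 := hgb t h7 (by linarith)
      refine lt_of_mul_lt_mul_left ?_ hpos.le
      rw [e1, e2]
      nlinarith

namespace ShortGame

open GameValue

/-! ### Walls, scaffolds and the freezing point of a game -/

theorem le_familyMax {n : ℕ} (f : Fin n → DyadicRat) (i : Fin n) : f i ≤ familyMax f := by
  rw [familyMax, dif_pos ⟨i, Finset.mem_univ i⟩]
  exact Finset.le_sup' f (Finset.mem_univ i)

theorem familyMin_le {n : ℕ} (f : Fin n → DyadicRat) (i : Fin n) : familyMin f ≤ f i := by
  rw [familyMin, dif_pos ⟨i, Finset.mem_univ i⟩]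
  exact Finset.inf'_le f (Finset.mem_univ i)

theorem exists_eq_familyMax {n : ℕ} (f : Fin n → DyadicRat) (i : Fin n) :
    ∃ j, familyMax f = f j := by
  rw [familyMax, dif_pos ⟨i, Finset.mem_univ i⟩]
  obtain ⟨j, -, hj⟩ := Finset.exists_mem_eq_sup' ⟨i, Finset.mem_univ i⟩ f
  exact ⟨j, hj⟩

theorem exists_eq_familyMin {n : ℕ} (f : Fin n → DyadicRat) (i : Fin n) :
    ∃ j, familyMin f = f j := by
  rw [familyMin, dif_pos ⟨i, Finset.mem_univ i⟩]
  obtain ⟨j, -, hj⟩ := Finset.exists_mem_eq_inf' ⟨i, Finset.mem_univ i⟩ f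
  exact ⟨j, hj⟩

/-- The Left wall `λ_t(G)`. -/
noncomputable def leftWall (G : ShortGame) (t : DyadicRat) : DyadicRat := (thermal G).leftWall t

/-- The Right wall `ρ_t(G)`. -/
noncomputable def rightWall (G : ShortGame) (t : DyadicRat) : DyadicRat := (thermal G).rightWall t

/-- The Left scaffold `max (ρ_t(G^L) - t)`. -/
noncomputable def leftTilde : ShortGame → DyadicRat → DyadicRat
  | mk _ _ L _ => leftScaffold fun i => thermal (L i)

/-- The Right scaffold `min (λ_t(G^R) + t)`. -/
noncomputable def rightTilde : ShortGame → DyadicRat → DyadicRat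
  | mk _ _ _ R => rightScaffold fun j => thermal (R j)

/-- The game `{(G^L)_t - t | (G^R)_t + t}`. -/
noncomputable def coolTilde : ShortGame → DyadicRat → ShortGame
  | mk _ _ L R => cooledTilde (fun i => thermal (L i)) fun j => thermal (R j)

/-- The least `t` at which the scaffolds meet. -/
noncomputable def freezing (G : ShortGame) : DyadicRat :=
  leastOf {t | leftTilde G t = rightTilde G t}

theorem thermal_of_equiv {G : ShortGame} {k : ℤ} (h : G ≈ ofInt k) (t : DyadicRat) :
    leftWall G t = k ∧ rightWall G t = k ∧ cool t G = ofInt k := by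
  obtain ⟨m, n, L, R⟩ := G
  have hG : ∃ k : ℤ, mk m n L R ≈ ofInt k := ⟨k, h⟩
  have hk : hG.choose = k := by
    have h1 := of_eq_of.2 (Setoid.trans (Setoid.symm hG.choose_spec) h)
    exact le_antisymm (of_ofInt_le.1 h1.le) (of_ofInt_le.1 h1.ge)
  rw [leftWall, rightWall, cool, thermal, dif_pos hG]
  simp only [hk, and_self]

theorem leftWall_eq {G : ShortGame} (h : ¬ IsInt G) (t : DyadicRat) :
    leftWall G t = if t ≤ freezing G then leftTilde G t else leftTilde G (freezing G) := by
  obtain ⟨m, n, L, R⟩ := G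
  unfold IsInt at h
  rw [leftWall, thermal, dif_neg h]
  rfl

theorem rightWall_eq {G : ShortGame} (h : ¬ IsInt G) (t : DyadicRat) :
    rightWall G t = if t ≤ freezing G then rightTilde G t else leftTilde G (freezing G) := by
  obtain ⟨m, n, L, R⟩ := G
  unfold IsInt at h
  rw [rightWall, thermal, dif_neg h]
  rfl

theorem cool_eq {G : ShortGame} (h : ¬ IsInt G) (t : DyadicRat) :
    cool t G = if t ≤ freezing G then coolTilde G t else ofDyadic (leftTilde G (freezing G)) := by
  obtain ⟨m, n, L, R⟩ := G
  unfold IsInt at h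
  rw [cool, thermal, dif_neg h]
  rfl

theorem isLeft_coolTilde {G x : ShortGame} {t : DyadicRat} :
    IsLeft x (coolTilde G t) ↔ ∃ y, IsLeft y G ∧ x = cool t y - ofDyadic t := by
  obtain ⟨m, n, L, R⟩ := G
  constructor
  · rintro ⟨i, rfl⟩
    exact ⟨L i, ⟨i, rfl⟩, rfl⟩
  · rintro ⟨_, ⟨i, rfl⟩, rfl⟩
    exact ⟨i, rfl⟩

theorem isRight_coolTilde {G x : ShortGame} {t : DyadicRat} :
    IsRight x (coolTilde G t) ↔ ∃ y, IsRight y G ∧ x = cool t y + ofDyadic t := by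
  obtain ⟨m, n, L, R⟩ := G
  constructor
  · rintro ⟨i, rfl⟩
    exact ⟨R i, ⟨i, rfl⟩, rfl⟩
  · rintro ⟨_, ⟨i, rfl⟩, rfl⟩
    exact ⟨i, rfl⟩

theorem IsLeft.le_leftTilde {x G : ShortGame} (h : IsLeft x G) (t : DyadicRat) :
    rightWall x t - t ≤ leftTilde G t := by
  obtain ⟨m, n, L, R⟩ := G
  obtain ⟨i, rfl⟩ := h
  exact le_familyMax (fun i => rightWall (L i) t - t) i

theorem IsRight.rightTilde_le {x G : ShortGame} (h : IsRight x G) (t : DyadicRat) :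
    rightTilde G t ≤ leftWall x t + t := by
  obtain ⟨m, n, L, R⟩ := G
  obtain ⟨i, rfl⟩ := h
  exact familyMin_le (fun i => leftWall (R i) t + t) i

theorem exists_leftTilde_eq {G : ShortGame} (h : ¬ IsInt G) (t : DyadicRat) :
    ∃ x, IsLeft x G ∧ leftTilde G t = rightWall x t - t := by
  obtain ⟨x, hx⟩ := exists_isLeft_of_not_isInt h
  obtain ⟨m, n, L, R⟩ := G
  obtain ⟨i, rfl⟩ := hx
  obtain ⟨j, hj⟩ := exists_eq_familyMax (fun i => rightWall (L i) t - t) i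
  exact ⟨L j, ⟨j, rfl⟩, hj⟩

theorem exists_rightTilde_eq {G : ShortGame} (h : ¬ IsInt G) (t : DyadicRat) :
    ∃ x, IsRight x G ∧ rightTilde G t = leftWall x t + t := by
  obtain ⟨x, hx⟩ := exists_isRight_of_not_isInt h
  obtain ⟨m, n, L, R⟩ := G
  obtain ⟨i, rfl⟩ := hx
  obtain ⟨j, hj⟩ := exists_eq_familyMin (fun i => leftWall (R i) t + t) i
  exact ⟨R j, ⟨j, rfl⟩, hj⟩

theorem exists_bound_isLeft {α : Type*} [SemilatticeSup α] [Nonempty α] {G : ShortGame}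
    {P : ShortGame → α → Prop} (hP : ∀ x a b, a ≤ b → P x a → P x b)
    (h : ∀ x, IsLeft x G → ∃ a, P x a) : ∃ a, ∀ x, IsLeft x G → P x a := by
  obtain ⟨m, n, L, R⟩ := G
  choose a ha using fun i => h (L i) ⟨i, rfl⟩
  obtain ⟨M, hM⟩ := Finite.exists_le a
  refine ⟨M, ?_⟩
  rintro _ ⟨i, rfl⟩
  exact hP _ _ _ (hM i) (ha i)

theorem exists_bound_isRight {α : Type*} [SemilatticeSup α] [Nonempty α] {G : ShortGame}
    {P : ShortGame → α → Prop} (hP : ∀ x a b, a ≤ b → P x a → P x b)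
    (h : ∀ x, IsRight x G → ∃ a, P x a) : ∃ a, ∀ x, IsRight x G → P x a := by
  obtain ⟨m, n, L, R⟩ := G
  choose a ha using fun i => h (R i) ⟨i, rfl⟩
  obtain ⟨M, hM⟩ := Finite.exists_le a
  refine ⟨M, ?_⟩
  rintro _ ⟨i, rfl⟩
  exact hP _ _ _ (hM i) (ha i)

theorem gridLinear_leftTilde {G : ShortGame} (hG : ¬ IsInt G) {N : ℕ}
    (h : ∀ x, IsLeft x G → GridLinear N 0 (rightWall x)) : GridLinear N (-1) (leftTilde G) := by
  obtain ⟨x, hx⟩ := exists_isLeft_of_not_isInt hG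
  obtain ⟨m, n, L, R⟩ := G
  obtain ⟨i, rfl⟩ := hx
  have hne : (Finset.univ : Finset (Fin m)).Nonempty := ⟨i, Finset.mem_univ i⟩
  have heq : leftTilde (mk m n L R) = Finset.univ.sup' hne fun i t => rightWall (L i) t - t := by
    funext t
    rw [Finset.sup'_apply]
    exact dif_pos hne
  rw [heq]
  exact Finset.sup'_induction hne _ (fun f hf g hg => hf.sup hg)
    fun i _ => (h (L i) ⟨i, rfl⟩).sub_id

theorem gridLinear_rightTilde {G : ShortGame} (hG : ¬ IsInt G) {N : ℕ}
    (h : ∀ x, IsRight x G → GridLinear N (-1) (leftWall x)) : GridLinear N 0 (rightTilde G) := by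
  obtain ⟨x, hx⟩ := exists_isRight_of_not_isInt hG
  obtain ⟨m, n, L, R⟩ := G
  obtain ⟨i, rfl⟩ := hx
  have hne : (Finset.univ : Finset (Fin n)).Nonempty := ⟨i, Finset.mem_univ i⟩
  have heq : rightTilde (mk m n L R) = Finset.univ.inf' hne fun i t => leftWall (R i) t + t := by
    funext t
    rw [Finset.inf'_apply]
    exact dif_pos hne
  rw [heq]
  exact Finset.inf'_induction hne _ (fun f hf g hg => hf.inf hg)
    fun i _ => (h (R i) ⟨i, rfl⟩).add_id

/-- The regularity of the walls of a game. The last field says that the walls at `-1` are the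
integer bounds of the game. -/
structure Tame (G : ShortGame) : Prop where
  left_antitone : Antitone (leftWall G)
  left_monotone : Monotone fun t => leftWall G t + t
  right_monotone : Monotone (rightWall G)
  right_antitone : Antitone fun t => rightWall G t - t
  grid : ∃ N, GridLinear N (-1) (leftWall G) ∧ GridLinear N 0 (rightWall G)
  mast : ∃ m, ∀ t, rightWall G t ≤ m ∧ m ≤ leftWall G t
  integral : ∃ a b : ℤ, leftWall G (-1) = a ∧ rightWall G (-1) = b ∧
    ∀ n : ℤ, (G ≤ ofInt n ↔ a ≤ n) ∧ (ofInt n ≤ G ↔ n ≤ b)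

/-! ### Regularity of walls and existence of the freezing point -/

theorem IsInt.tame {G : ShortGame} (h : IsInt G) : Tame G := by
  obtain ⟨k, hk⟩ := h
  have hl : leftWall G = fun _ => (k : DyadicRat) := funext fun t => (thermal_of_equiv hk t).1
  have hr : rightWall G = fun _ => (k : DyadicRat) := funext fun t => (thermal_of_equiv hk t).2.1
  refine ⟨?_, ?_, ?_, ?_, ⟨0, ?_, ?_⟩, ⟨k, ?_⟩, ⟨k, k, ?_, ?_, fun n => ?_⟩⟩
  · rw [hl]; exact antitone_const
  · rw [hl]; exact fun s t h => add_le_add le_rfl h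
  · rw [hr]; exact monotone_const
  · rw [hr]; exact fun s t h => sub_le_sub le_rfl h
  · rw [hl]; exact GridLinear.const 0 (by simp) k
  · rw [hr]; exact GridLinear.const 0 (by simp) k
  · intro t; rw [hl, hr]; exact ⟨le_rfl, le_rfl⟩
  · rw [hl]
  · rw [hr]
  · rw [← of_le_of, ← of_le_of, of_eq_of.2 hk, of_ofInt_le, of_ofInt_le]
    exact ⟨Iff.rfl, Iff.rfl⟩

theorem leftTilde_antitone {G : ShortGame}
    (hG : ¬ IsInt G) (hL : ∀ x, IsLeft x G → Tame x) :
    Antitone (leftTilde G) := fun s t h => by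
  obtain ⟨x, hx, he⟩ := exists_leftTilde_eq hG t
  rw [he]
  exact ((hL x hx).right_antitone h).trans (hx.le_leftTilde s)

theorem leftTilde_add_monotone {G : ShortGame}
    (hG : ¬ IsInt G) (hL : ∀ x, IsLeft x G → Tame x) :
    Monotone fun t => leftTilde G t + t := fun s t h => by
  obtain ⟨x, hx, he⟩ := exists_leftTilde_eq hG s
  have h1 := (hL x hx).right_monotone h
  have h2 := hx.le_leftTilde t
  dsimp only
  linarith

theorem rightTilde_monotone {G : ShortGame}
    (hG : ¬ IsInt G) (hR : ∀ x, IsRight x G → Tame x) :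
    Monotone (rightTilde G) := fun s t h => by
  obtain ⟨x, hx, he⟩ := exists_rightTilde_eq hG t
  rw [he]
  exact (hx.rightTilde_le s).trans ((hR x hx).left_monotone h)

theorem rightTilde_sub_antitone {G : ShortGame}
    (hG : ¬ IsInt G) (hR : ∀ x, IsRight x G → Tame x) :
    Antitone fun t => rightTilde G t - t := fun s t h => by
  obtain ⟨x, hx, he⟩ := exists_rightTilde_eq hG s
  have h1 := (hR x hx).left_antitone h
  have h2 := hx.rightTilde_le t
  dsimp only
  linarith

/-- Otherwise let `b` be the largest Right wall at `-1` among the Left options. Then `b + 1` is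
below no Left option, and every Right option has Left wall at least `b + 2` there, so `b + 1` fits
and `G` is an integer. -/
theorem rightTilde_neg_one_lt {G : ShortGame}
    (hG : ¬ IsInt G) (hL : ∀ x, IsLeft x G → Tame x) (hR : ∀ x, IsRight x G → Tame x) :
    rightTilde G (-1) < leftTilde G (-1) := by
  by_contra hle
  obtain ⟨x, hx, hxe⟩ := exists_leftTilde_eq hG (-1)
  obtain ⟨a, b, ha, hb, hab⟩ := (hL x hx).integral
  refine hG (isInt_of_fits (b + 1) (fun y hy h => ?_) fun y hy h => ?_)
  · obtain ⟨a', b', ha', hb', hab'⟩ := (hL y hy).integral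
    have h1 := hy.le_leftTilde (-1)
    rw [hxe, hb, hb', sub_le_sub_iff_right, Int.cast_le] at h1
    have := (hab' _).2.1 h
    omega
  · obtain ⟨a', b', ha', hb', hab'⟩ := (hR y hy).integral
    have h1 := (not_lt.1 hle).trans (hy.rightTilde_le (-1))
    rw [hxe, hb, ha'] at h1
    have h2 : ((b + 1 : ℤ) : DyadicRat) ≤ ((a' - 1 : ℤ) : DyadicRat) := by
      push_cast; linarith
    have := (hab' _).1.1 h
    have := Int.cast_le.1 h2
    omega

theorem exists_grid {G : ShortGame}
    (hL : ∀ x, IsLeft x G → Tame x) (hR : ∀ x, IsRight x G → Tame x) :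
    ∃ N, (∀ x, IsLeft x G → GridLinear N 0 (rightWall x)) ∧
    ∀ x, IsRight x G → GridLinear N (-1) (leftWall x) := by
  obtain ⟨N, hN⟩ := exists_bound_isLeft (G := G) (P := fun x N => GridLinear N 0 (rightWall x))
    (fun x a b h h' => h'.mono h) fun x hx => by
      obtain ⟨N, -, h⟩ := (hL x hx).grid
      exact ⟨N, h⟩
  obtain ⟨M, hM⟩ := exists_bound_isRight (G := G) (P := fun x N => GridLinear N (-1) (leftWall x))
    (fun x a b h h' => h'.mono h) fun x hx => by
      obtain ⟨N, h, -⟩ := (hR x hx).grid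
      exact ⟨N, h⟩
  exact ⟨max N M, fun x hx => (hN x hx).mono (le_max_left _ _),
    fun x hx => (hM x hx).mono (le_max_right _ _)⟩

/-- The options' relevant walls are bounded, while the tax `∓T` is not: once `T` exceeds both
bounds, the Left scaffold is at most `0` and the Right one at least `0`. -/
theorem exists_leftTilde_le_rightTilde {G : ShortGame}
    (hG : ¬ IsInt G) (hL : ∀ x, IsLeft x G → Tame x) (hR : ∀ x, IsRight x G → Tame x) :
    ∃ T, leftTilde G T ≤ rightTilde G T := by
  obtain ⟨M, hM⟩ := exists_bound_isLeft (G := G)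
    (P := fun x (m : DyadicRat) => ∀ t, rightWall x t ≤ m)
    (fun x a b h h' t => (h' t).trans h) fun x hx => by
      obtain ⟨m, h⟩ := (hL x hx).mast
      exact ⟨m, fun t => (h t).1⟩
  obtain ⟨M', hM'⟩ := exists_bound_isRight (G := G)
    (P := fun x (m : DyadicRat) => ∀ t, -m ≤ leftWall x t)
    (fun x a b h h' t => (neg_le_neg h).trans (h' t)) fun x hx => by
      obtain ⟨m, h⟩ := (hR x hx).mast
      exact ⟨-m, fun t => by rw [neg_neg]; exact (h t).2⟩
  refine ⟨max M M', ?_⟩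
  obtain ⟨x, hx, hxe⟩ := exists_leftTilde_eq hG (max M M')
  obtain ⟨y, hy, hye⟩ := exists_rightTilde_eq hG (max M M')
  rw [hxe, hye]
  have h1 := hM x hx (max M M')
  have h2 := hM' y hy (max M M')
  have h3 := le_max_left M M'
  have h4 := le_max_right M M'
  linarith

/-- Shows that `leastOf` takes its genuine value here. The freezing point is a point of the grid,
which is what lets the frozen walls of `G` stay grid-linear. -/
theorem freezing_spec {G : ShortGame}
    (hG : ¬ IsInt G) (hL : ∀ x, IsLeft x G → Tame x) (hR : ∀ x, IsRight x G → Tame x) :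
    ∃ (N : ℕ) (K : ℤ), GridLinear N (-1) (leftTilde G) ∧
    GridLinear N 0 (rightTilde G) ∧ 2 ^ N * freezing G = K ∧
    leftTilde G (freezing G) = rightTilde G (freezing G) ∧
    ∀ t < freezing G, rightTilde G t < leftTilde G t := by
  obtain ⟨N, hN, hN'⟩ := exists_grid hL hR
  obtain ⟨T, hT⟩ := exists_leftTilde_le_rightTilde hG hL hR
  have hl := gridLinear_leftTilde hG hN
  have hr := gridLinear_rightTilde hG hN'
  obtain ⟨τ, K, hK, hτ, hlt⟩ := hl.exists_first_crossing hr (leftTilde_antitone hG hL)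
    (rightTilde_monotone hG hR) (rightTilde_neg_one_lt hG hL hR) hT
  have hleast : IsLeast {t | leftTilde G t = rightTilde G t} τ :=
    ⟨hτ, fun t ht => not_lt.1 fun h => (hlt t h).ne' ht⟩
  have hfr : freezing G = τ := by
    have hex : ∃ a, IsLeast {t | leftTilde G t = rightTilde G t} a := ⟨τ, hleast⟩
    rw [freezing, leastOf, dif_pos hex]
    exact hex.choose_spec.unique hleast
  rw [hfr]
  exact ⟨N + 1, K, hl.succ, hr.succ, hK, hτ, hlt⟩

theorem neg_one_lt_freezing_of_options {G : ShortGame}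
    (hG : ¬ IsInt G) (hL : ∀ x, IsLeft x G → Tame x) (hR : ∀ x, IsRight x G → Tame x) :
    -1 < freezing G := by
  obtain ⟨_, _, -, -, -, hτ, -⟩ := freezing_spec hG hL hR
  by_contra h
  have h1 := leftTilde_antitone hG hL (not_lt.1 h)
  have h2 := rightTilde_monotone hG hR (not_lt.1 h)
  have h3 := rightTilde_neg_one_lt hG hL hR
  rw [hτ] at h1
  exact absurd (h1.trans h2) (not_le.2 h3)

theorem tame_of_options {G : ShortGame}
    (hG : ¬ IsInt G) (hL : ∀ x, IsLeft x G → Tame x) (hR : ∀ x, IsRight x G → Tame x) :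
    Tame G := by
  obtain ⟨N, K, hl, hr, hK, hτ, hlt⟩ := freezing_spec hG hL hR
  set τ := freezing G with hτdef
  have hneg : -1 < τ := neg_one_lt_freezing_of_options hG hL hR
  have hlw : leftWall G = fun t => if t ≤ τ then leftTilde G t else leftTilde G τ :=
    funext fun t => leftWall_eq hG t
  have hrw : rightWall G = fun t => if t ≤ τ then rightTilde G t else rightTilde G τ :=
    funext fun t => by rw [rightWall_eq hG t, ← hτdef, hτ]
  have la := leftTilde_antitone hG hL
  have lm := leftTilde_add_monotone hG hL
  have rm := rightTilde_monotone hG hR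
  have ra := rightTilde_sub_antitone hG hR
  refine ⟨?_, ?_, ?_, ?_, ⟨N, ?_, ?_⟩, ⟨leftTilde G τ, fun t => ⟨?_, ?_⟩⟩, ?_⟩
  · rw [hlw]
    intro s t h
    dsimp only
    split_ifs with h1 h2 h2
    · exact la h
    · exact absurd (h.trans h1) h2
    · exact la h2
    · exact le_rfl
  · rw [hlw]
    intro s t h
    dsimp only
    split_ifs with h1 h2 h2
    · exact lm h
    · have := lm h1
      dsimp only at this
      linarith
    · exact absurd (h.trans h2) h1
    · linarith
  · rw [hrw]
    intro s t h
    dsimp only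
    split_ifs with h1 h2 h2
    · exact rm h
    · exact rm h1
    · exact absurd (h.trans h2) h1
    · exact le_rfl
  · rw [hrw]
    intro s t h
    dsimp only
    split_ifs with h1 h2 h2
    · exact ra h
    · exact absurd (h.trans h1) h2
    · have := ra h2
      dsimp only at this
      linarith
    · linarith
  · rw [hlw]; exact hl.freeze (by simp) hK
  · rw [hrw]; exact hr.freeze (by simp) hK
  · rw [hrw, hτ]
    dsimp only
    split_ifs with h
    · exact rm h
    · exact le_rfl
  · rw [hlw]
    dsimp only
    split_ifs with h
    · exact la h
    · exact le_rfl
  · have e1 : leftWall G (-1) = leftTilde G (-1) := by rw [hlw]; exact if_pos hneg.le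
    have e2 : rightWall G (-1) = rightTilde G (-1) := by rw [hrw]; exact if_pos hneg.le
    obtain ⟨x, hx, hxe⟩ := exists_leftTilde_eq hG (-1)
    obtain ⟨y, hy, hye⟩ := exists_rightTilde_eq hG (-1)
    obtain ⟨a, b, ha, hb, hab⟩ := (hL x hx).integral
    obtain ⟨c, d, hc, hd, hcd⟩ := (hR y hy).integral
    refine ⟨b + 1, c - 1, by rw [e1, hxe, hb]; push_cast; ring,
      by rw [e2, hye, hc]; push_cast; ring, fun n => ⟨⟨fun h => ?_, fun h => ?_⟩,
      ⟨fun h => ?_, fun h => ?_⟩⟩⟩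
    · by_contra hlt
      exact (le_iff.1 h).1 x hx ((hab n).2.2 (by omega))
    · have hn : ∀ z, IsLeft z G → ¬ ofInt n ≤ z := fun z hz hle => by
        obtain ⟨a', b', -, hb', hab'⟩ := (hL z hz).integral
        have h1 := hz.le_leftTilde (-1)
        rw [hxe, hb, hb', sub_le_sub_iff_right, Int.cast_le] at h1
        have := (hab' n).2.1 hle
        omega
      -- No Left option is `≥ n`, so the failure must come from the Right option `n + 1` of `n`
      -- lying below `G`. Then `n + 1` fits between the options and `G` would be an integer.
      by_contra hnle
      rcases not_le_iff.1 hnle with ⟨z, hz, hle⟩ | ⟨z, hz, hle⟩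
      · exact hn z hz hle
      · obtain ⟨-, rfl⟩ := isRight_ofInt.1 hz
        refine hG (isInt_of_fits (n + 1) (fun w hw h' => hn w hw ?_) fun w hw h' => ?_)
        · exact (of_le_of.1 (of_ofInt_le.2 (by omega))).trans h'
        · exact hw.not_le (h'.trans hle)
    · by_contra hlt
      exact (le_iff.1 h).2 y hy ((hcd n).1.2 (by omega))
    · have hn : ∀ z, IsRight z G → ¬ z ≤ ofInt n := fun z hz hle => by
        obtain ⟨a', b', ha', -, hab'⟩ := (hR z hz).integral
        have h1 := hz.rightTilde_le (-1)
        rw [hye, hc, ha', add_le_add_iff_right, Int.cast_le] at h1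
        have := (hab' n).1.1 hle
        omega
      by_contra hnle
      rcases not_le_iff.1 hnle with ⟨z, hz, hle⟩ | ⟨z, hz, hle⟩
      · obtain ⟨-, rfl⟩ := isLeft_ofInt.1 hz
        refine hG (isInt_of_fits (n - 1) (fun w hw h' => ?_) fun w hw h' => hn w hw ?_)
        · exact hw.not_le (hle.trans h')
        · exact h'.trans (of_le_of.1 (of_ofInt_le.2 (by omega)))
      · exact hn z hz hle

theorem tame (G : ShortGame) : Tame G := by
  by_cases hG : IsInt G
  · exact hG.tame
  · exact tame_of_options hG (fun x hx => have := hx.lt; tame x) fun x hx => have := hx.lt; tame x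
termination_by G.birthday

theorem leftTilde_freezing {G : ShortGame} (hG : ¬ IsInt G) :
    leftTilde G (freezing G) = rightTilde G (freezing G) := by
  obtain ⟨_, _, -, -, -, h, -⟩ := freezing_spec hG (fun x _ => tame x) fun x _ => tame x
  exact h

theorem rightTilde_le_leftTilde {G : ShortGame} (hG : ¬ IsInt G) {t : DyadicRat}
    (ht : t ≤ freezing G) : rightTilde G t ≤ leftTilde G t := by
  obtain ⟨_, _, -, -, -, h, h'⟩ := freezing_spec hG (fun x _ => tame x) fun x _ => tame x
  rcases ht.eq_or_lt with rfl | ht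
  · exact h.ge
  · exact (h' t ht).le

theorem neg_one_lt_freezing {G : ShortGame} (hG : ¬ IsInt G) : -1 < freezing G :=
  neg_one_lt_freezing_of_options hG (fun x _ => tame x) fun x _ => tame x

/-! ### Cooled games before and after freezing -/

open Classical in
/-- The temperature of `G`, with `-1` in place of `-∞` for integers. -/
noncomputable def heat (G : ShortGame) : DyadicRat := if IsInt G then -1 else freezing G

theorem isInt_of_heat_le {G : ShortGame} (h : heat G ≤ -1) : IsInt G := by
  by_contra hG
  rw [heat, if_neg hG] at h
  exact absurd (neg_one_lt_freezing hG) (not_lt.2 h)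

theorem leftWall_of_heat_le {G : ShortGame} {t : DyadicRat} (h : heat G ≤ t) :
    leftWall G t = leftWall G (heat G) := by
  by_cases hG : IsInt G
  · obtain ⟨k, hk⟩ := hG
    rw [(thermal_of_equiv hk _).1, (thermal_of_equiv hk _).1]
  · rw [heat, if_neg hG] at h ⊢
    rw [leftWall_eq hG, leftWall_eq hG, if_pos le_rfl]
    split_ifs with h'
    · rw [le_antisymm h' h]
    · rfl

theorem rightWall_of_heat_le {G : ShortGame} {t : DyadicRat} (h : heat G ≤ t) :
    rightWall G t = leftWall G (heat G) := by
  by_cases hG : IsInt G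
  · obtain ⟨k, hk⟩ := hG
    rw [(thermal_of_equiv hk _).1, (thermal_of_equiv hk _).2.1]
  · rw [heat, if_neg hG] at h ⊢
    rw [leftWall_eq hG, rightWall_eq hG, if_pos le_rfl]
    split_ifs with h'
    · rw [le_antisymm h' h, leftTilde_freezing hG]
    · rfl

theorem cool_of_heat_lt {G : ShortGame} {t : DyadicRat} (h : heat G < t) :
    of (cool t G) = number (leftWall G (heat G)) := by
  by_cases hG : IsInt G
  · obtain ⟨k, hk⟩ := hG
    rw [(thermal_of_equiv hk _).1, (thermal_of_equiv hk _).2.2, number_intCast]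
  · rw [heat, if_neg hG] at h ⊢
    rw [leftWall_eq hG, cool_eq hG, if_pos le_rfl, if_neg (not_le.2 h), number]

section Active

variable {G : ShortGame} {t : DyadicRat}

theorem not_isInt_of_le_heat (ht : -1 < t) (h : t ≤ heat G) : ¬ IsInt G := fun hG => by
  rw [heat, if_pos hG] at h
  exact absurd ht (not_lt.2 h)

theorem le_freezing_of_le_heat (ht : -1 < t) (h : t ≤ heat G) : t ≤ freezing G := by
  rwa [heat, if_neg (not_isInt_of_le_heat ht h)] at h

theorem cool_of_le_heat (ht : -1 < t) (h : t ≤ heat G) : cool t G = coolTilde G t := by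
  rw [cool_eq (not_isInt_of_le_heat ht h), if_pos (le_freezing_of_le_heat ht h)]

end Active

theorem leftWall_of_le_freezing {G : ShortGame} {t : DyadicRat} (hG : ¬ IsInt G)
    (h : t ≤ freezing G) : leftWall G t = leftTilde G t := by
  rw [leftWall_eq hG, if_pos h]

theorem rightWall_of_le_freezing {G : ShortGame} {t : DyadicRat} (hG : ¬ IsInt G)
    (h : t ≤ freezing G) : rightWall G t = rightTilde G t := by
  rw [rightWall_eq hG, if_pos h]

/-! ### Unsettled games -/

/-- No two numbers `y < z` separate the Left options from the Right options. -/
def Unsettled (A : ShortGame) : Prop :=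
  ∀ y z : DyadicRat, (∀ x, IsLeft x A → ¬ number y ≤ of x) →
    (∀ x, IsRight x A → ¬ of x ≤ number z) → z ≤ y

/-- Number avoidance. Were the comparison refuted by a Left option `p < q` of the number, so that `A
≤ p`, no Left option of `A` would be `≥ p`, and `p < q` would separate the options of `A`. -/
theorem Unsettled.number_le {A : ShortGame} (hA : Unsettled A) {q : DyadicRat}
    (h : ∀ x, IsRight x A → ¬ of x ≤ number q) : number q ≤ of A := by
  by_contra hle
  rcases not_le_iff.1 hle with ⟨z, hz, hAz⟩ | ⟨z, hz, hzq⟩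
  · obtain ⟨p, hp, hzp⟩ := hz.of_ofDyadic
    rw [← of_le_of, hzp] at hAz
    exact absurd (hA p q (fun x hx hpx => hx.not_le (hAz.trans hpx)) h) (not_le.2 hp)
  · exact h z hz hzq

theorem Unsettled.le_number {A : ShortGame} (hA : Unsettled A) {q : DyadicRat}
    (h : ∀ x, IsLeft x A → ¬ number q ≤ of x) : of A ≤ number q := by
  by_contra hle
  rcases not_le_iff.1 hle with ⟨z, hz, hqz⟩ | ⟨z, hz, hzA⟩
  · exact h z hz hqz
  · obtain ⟨p, hp, hzp⟩ := hz.of_ofDyadic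
    rw [← of_le_of, hzp] at hzA
    exact absurd (hA q p h fun x hx hxp => hx.not_le (hxp.trans hzA)) (not_le.2 hp)

theorem Unsettled.of_options {A B : ShortGame} (hA : Unsettled A) (q : DyadicRat)
    (hL : ∀ x, IsLeft x A → ∃ y, IsLeft y B ∧ of y = of x + number q)
    (hR : ∀ x, IsRight x A → ∃ y, IsRight y B ∧ of y = of x + number q) : Unsettled B := by
  intro y z hy hz
  have h := hA (y - q) (z - q) (fun x hx hle => ?_) fun x hx hle => ?_
  · exact (sub_le_sub_iff_right q).1 h
  · obtain ⟨x', hx', he⟩ := hL x hx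
    refine hy x' hx' ?_
    rw [he, ← sub_le_iff_le_add, ← number_sub]
    exact hle
  · obtain ⟨x', hx', he⟩ := hR x hx
    refine hz x' hx' ?_
    rw [he, ← le_sub_iff_add_le, ← number_sub]
    exact hle

/-- Take the least multiple of `ε` that bounds `C`. -/
theorem exists_tight_upper_bound (C : ShortGame) {ε : DyadicRat} (hε : 0 < ε) :
    ∃ q, of C ≤ number q ∧ ¬ of C ≤ number (q - ε) := by
  obtain ⟨p, hp⟩ := exists_number_le C
  obtain ⟨r, hr⟩ := exists_le_number C
  have harch : ∀ x : DyadicRat, ∃ n : ℕ, x ≤ n * ε := fun x => by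
    obtain ⟨n, hn⟩ := Archimedean.arch (x : ℚ) (y := (ε : ℚ)) (by exact_mod_cast hε)
    exact ⟨n, by rw [← Subtype.coe_le_coe]; simpa using hn⟩
  obtain ⟨k, hk, hmin⟩ := Int.exists_least_of_bdd (P := fun k : ℤ => of C ≤ number (k * ε))
    (by
      obtain ⟨n, hn⟩ := harch (-p)
      refine ⟨-n, fun z hz => ?_⟩
      have h1 := number_le_number.1 (hp.trans hz)
      have h2 : ((-n : ℤ) : DyadicRat) ≤ z :=
        le_of_mul_le_mul_right (by push_cast; linarith) hε
      exact_mod_cast h2)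
    (by
      obtain ⟨n, hn⟩ := harch r
      exact ⟨n, hr.trans (number_le_number.2 (by push_cast; exact hn))⟩)
  refine ⟨k * ε, hk, fun h => ?_⟩
  have := hmin (k - 1) (by convert h using 2; push_cast; ring)
  omega

/-- Suppose `y < z` separates the options of the sum, and let `q` bound `C` from above tightly to
within `ε = z - y`. No Right move in `B` reaches `≤ z - q`, so `z - q ≤ B`. Then no Left move in `C`
reaches `≥ q - ε`, so `C ≤ q - ε`, against tightness. -/
theorem Unsettled.add {B C : ShortGame} (hB : Unsettled B) (hC : Unsettled C) :
    Unsettled (B + C) := by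
  intro y z hy hz
  by_contra hlt
  rw [not_le] at hlt
  obtain ⟨ε, hε, hε'⟩ : ∃ ε : DyadicRat, 0 < ε ∧ y + ε ≤ z := ⟨z - y, by linarith, by linarith⟩
  obtain ⟨q, hq, hq'⟩ := exists_tight_upper_bound C hε
  have h1 : number (z - q) ≤ of B := hB.number_le fun x hx hle => by
    refine hz (x + C) (isRight_add.2 (.inl ⟨x, hx, rfl⟩)) ?_
    have := add_le_add hle hq
    rwa [← number_add, sub_add_cancel] at this
  refine hq' (hC.le_number fun x hx hle => ?_)
  refine hy (B + x) (isLeft_add.2 (.inr ⟨x, hx, rfl⟩)) ?_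
  have := add_le_add h1 hle
  rw [← number_add] at this
  exact (number_le_number.2 (by linarith)).trans this

theorem Unsettled.add_number {A B : ShortGame} (hA : Unsettled A) {q : DyadicRat}
    (hB : of B = number q) : Unsettled (A + B) :=
  hA.of_options q
    (fun x hx => ⟨x + B, isLeft_add.2 (.inl ⟨x, hx, rfl⟩), by rw [of_add, hB]⟩)
    fun x hx => ⟨x + B, isRight_add.2 (.inl ⟨x, hx, rfl⟩), by rw [of_add, hB]⟩

theorem Unsettled.number_add {A B : ShortGame} (hA : Unsettled A) {q : DyadicRat}
    (hB : of B = number q) : Unsettled (B + A) :=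
  hA.of_options q
    (fun x hx => ⟨B + x, isLeft_add.2 (.inr ⟨x, hx, rfl⟩), by rw [of_add, hB, add_comm]⟩)
    fun x hx => ⟨B + x, isRight_add.2 (.inr ⟨x, hx, rfl⟩), by rw [of_add, hB, add_comm]⟩

/-! ### Walls bound the cooled game -/

/-- A separating pair `y`, `z` must have `y` at or above the Left scaffold and `z` at or below the
Right one, and up to freezing the Right scaffold does not exceed the Left. -/
theorem unsettled_coolTilde_of_bounds {G : ShortGame} (hG : ¬ IsInt G) {t : DyadicRat}
    (h : t ≤ freezing G)
    (hL : ∀ x, IsLeft x G → ∀ q < rightWall x t, number q ≤ of (cool t x))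
    (hR : ∀ x, IsRight x G → ∀ q, leftWall x t < q → of (cool t x) ≤ number q) :
    Unsettled (coolTilde G t) := by
  intro y z hy hz
  have h1 : leftTilde G t ≤ y := by
    obtain ⟨x, hx, he⟩ := exists_leftTilde_eq hG t
    rw [he]
    by_contra hlt
    refine hy _ (isLeft_coolTilde.2 ⟨x, hx, rfl⟩) ?_
    rw [of_sub, le_sub_iff_add_le]
    change number y + number t ≤ _
    rw [← ShortGame.number_add]
    exact hL x hx _ (by linarith)
  have h2 : z ≤ rightTilde G t := by
    obtain ⟨x, hx, he⟩ := exists_rightTilde_eq hG t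
    rw [he]
    by_contra hlt
    refine hz _ (isRight_coolTilde.2 ⟨x, hx, rfl⟩) ?_
    rw [of_add, ← le_sub_iff_add_le]
    change _ ≤ number z - number t
    rw [← number_sub]
    exact hR x hx _ (by linarith)
  exact h2.trans ((rightTilde_le_leftTilde hG h).trans h1)

theorem not_cool_le_of_isLeft {G x : ShortGame} (hx : IsLeft x G) (t : DyadicRat) :
    ¬ of (coolTilde G t) ≤ of (cool t x) - number t := by
  have := (isLeft_coolTilde.2 ⟨x, hx, rfl⟩ : IsLeft (cool t x - ofDyadic t) (coolTilde G t)).not_le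
  rwa [of_sub] at this

theorem not_cool_le_of_isRight {G x : ShortGame} (hx : IsRight x G) (t : DyadicRat) :
    ¬ of (cool t x) + number t ≤ of (coolTilde G t) :=
  (isRight_coolTilde.2 ⟨x, hx, rfl⟩ : IsRight (cool t x + ofDyadic t) (coolTilde G t)).not_le

/-- The walls at `t` are the stops of the game cooled by `t`. -/
structure WallBounds (t : DyadicRat) (G : ShortGame) : Prop where
  number_le : ∀ q < rightWall G t, number q ≤ of (cool t G)
  le_number : ∀ q, leftWall G t < q → of (cool t G) ≤ number q
  not_le_number : ∀ q < leftWall G t, ¬ of (cool t G) ≤ number q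
  not_number_le : ∀ q, rightWall G t < q → ¬ number q ≤ of (cool t G)

/-- Frozen games are numbers. For active ones number avoidance reduces each bound to the options.
Comparison with the wall value itself is left open, since it may depend on infinitesimals. -/
theorem wallBounds {t : DyadicRat} (ht : -1 < t) (G : ShortGame) : WallBounds t G := by
  rcases lt_or_ge (heat G) t with h | h
  · have hc := cool_of_heat_lt h
    have hl := leftWall_of_heat_le h.le
    have hr := rightWall_of_heat_le h.le
    constructor <;> intro q hq
    · rw [hc]; rw [hr] at hq; exact number_le_number.2 hq.le
    · rw [hc]; rw [hl] at hq; exact number_le_number.2 hq.le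
    · rw [hc, number_le_number]; rw [hl] at hq; exact not_le.2 hq
    · rw [hc, number_le_number]; rw [hr] at hq; exact not_le.2 hq
  · have hG := not_isInt_of_le_heat ht h
    have hf := le_freezing_of_le_heat ht h
    have hL : ∀ x, IsLeft x G → WallBounds t x := fun x hx => have := hx.lt; wallBounds ht x
    have hR : ∀ x, IsRight x G → WallBounds t x := fun x hx => have := hx.lt; wallBounds ht x
    have hU := unsettled_coolTilde_of_bounds hG hf (fun x hx => (hL x hx).number_le)
      fun x hx => (hR x hx).le_number
    have hc := cool_of_le_heat ht h
    have hl := leftWall_of_le_freezing hG hf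
    have hr := rightWall_of_le_freezing hG hf
    constructor <;> intro q hq
    · rw [hc]
      rw [hr] at hq
      refine hU.number_le fun x hx hle => ?_
      obtain ⟨y, hy, rfl⟩ := isRight_coolTilde.1 hx
      refine (hR y hy).not_le_number (q - t) ?_ ?_
      · have := hy.rightTilde_le t
        linarith
      · rw [number_sub, le_sub_iff_add_le]
        exact hle
    · rw [hc]
      rw [hl] at hq
      refine hU.le_number fun x hx hle => ?_
      obtain ⟨y, hy, rfl⟩ := isLeft_coolTilde.1 hx
      refine (hL y hy).not_number_le (q + t) ?_ ?_
      · have := hy.le_leftTilde t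
        linarith
      · rw [of_sub, le_sub_iff_add_le] at hle
        rw [ShortGame.number_add]
        exact hle
    · rw [hc]
      rw [hl] at hq
      intro hle
      obtain ⟨x, hx, he⟩ := exists_leftTilde_eq hG t
      refine not_cool_le_of_isLeft hx t (hle.trans ?_)
      rw [le_sub_iff_add_le, ← ShortGame.number_add]
      exact (hL x hx).number_le _ (by linarith)
    · rw [hc]
      rw [hr] at hq
      intro hle
      obtain ⟨x, hx, he⟩ := exists_rightTilde_eq hG t
      refine not_cool_le_of_isRight hx t (le_trans ?_ hle)
      rw [← le_sub_iff_add_le, ← number_sub]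
      exact (hR x hx).le_number _ (by linarith)
termination_by G.birthday

theorem unsettled_coolTilde {G : ShortGame} {t : DyadicRat} (ht : -1 < t) (h : t ≤ heat G) :
    Unsettled (coolTilde G t) :=
  unsettled_coolTilde_of_bounds (not_isInt_of_le_heat ht h) (le_freezing_of_le_heat ht h)
    (fun x _ => (wallBounds ht x).number_le) fun x _ => (wallBounds ht x).le_number

/-- Bounds on the walls at a lower temperature give sharp bounds on the cooled game. -/
theorem cool_le_of_wall_le {s t : DyadicRat} (ht : -1 < t) (hst : s < t) (G : ShortGame)
    (x : DyadicRat) :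
    (leftWall G s ≤ x → of (cool t G) ≤ number x) ∧
      (rightWall G s - s ≤ x → ¬ number x ≤ of (cool t G) - number t) := by
  rcases lt_or_ge (heat G) t with h | h
  · rw [cool_of_heat_lt h, ← number_sub, number_le_number, number_le_number, not_le]
    refine ⟨fun hx => ?_, fun hx => ?_⟩
    · rw [← leftWall_of_heat_le h.le]
      exact ((tame G).left_antitone hst.le).trans hx
    -- Going from `s` to `max s (heat G)`, the quantity `ρ - id` does not grow and `ρ` reaches the
    -- frozen value. As that maximum is still below `t`, the inequality becomes strict.
    · have h1 := (tame G).right_antitone (le_max_left s (heat G))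
      dsimp only at h1
      rw [rightWall_of_heat_le (le_max_right s (heat G))] at h1
      have h2 := max_lt hst h
      linarith
  · have hG := not_isInt_of_le_heat ht h
    have hf := le_freezing_of_le_heat ht h
    rw [cool_of_le_heat ht h, leftWall_of_le_freezing hG (hst.le.trans hf),
      rightWall_of_le_freezing hG (hst.le.trans hf)]
    refine ⟨fun hx => (unsettled_coolTilde ht h).le_number fun y hy => ?_, fun hx hle => ?_⟩
    · obtain ⟨z, hz, rfl⟩ := isLeft_coolTilde.1 hy
      have := hz.lt
      rw [of_sub]
      exact (cool_le_of_wall_le ht hst z x).2 ((hz.le_leftTilde s).trans hx)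
    · obtain ⟨z, hz, he⟩ := exists_rightTilde_eq hG s
      have := hz.lt
      refine not_cool_le_of_isRight hz t (le_trans ?_ (le_sub_iff_add_le.1 hle))
      rw [add_le_add_iff_right]
      exact (cool_le_of_wall_le ht hst z x).1 (by linarith)
termination_by G.birthday

/-- For active `G` this is a Left option of `G_t`. For frozen `G`, the Left scaffold at the freezing
point bounds `ρ(x) - id` there by the frozen value, and `cool_le_of_wall_le` transports this to `t`.
An integer behaves as if frozen at `-1`, where the integrality of the wall of `x` supplies the
bound. -/
theorem not_cool_le_cool_sub {t : DyadicRat} (ht : -1 < t) {G x : ShortGame} (hx : IsLeft x G) :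
    ¬ of (cool t G) ≤ of (cool t x) - number t := by
  rcases lt_or_ge (heat G) t with h | h
  · rw [cool_of_heat_lt h]
    by_cases hG : IsInt G
    · obtain ⟨k, hk⟩ := hG
      refine (cool_le_of_wall_le ht ht x _).2 ?_
      obtain ⟨a, b, -, hb, hab⟩ := (tame x).integral
      have hlt : b < k := by
        by_contra hle
        exact hx.not_le ((of_eq_of.2 hk).le.trans (of_le_of.2 ((hab k).2.2 (not_lt.1 hle))))
      rw [(thermal_of_equiv hk _).1, hb]
      have : ((b + 1 : ℤ) : DyadicRat) ≤ k := Int.cast_le.2 hlt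
      push_cast at this
      linarith
    · rw [heat, if_neg hG] at h ⊢
      refine (cool_le_of_wall_le ht h x _).2 ?_
      rw [leftWall_of_le_freezing hG le_rfl]
      exact hx.le_leftTilde _
  · rw [cool_of_le_heat ht h]
    exact not_cool_le_of_isLeft hx t

/-! ### Cooling respects the order of sums -/

open Classical in
/-- The part of the game cooled by `t` in which there is still play. -/
noncomputable def core (t : DyadicRat) (G : ShortGame) : ShortGame :=
  if heat G < t then 0 else coolTilde G t

open Classical in
/-- The frozen part of the game cooled by `t`. -/
noncomputable def settled (t : DyadicRat) (G : ShortGame) : DyadicRat :=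
  if heat G < t then leftWall G (heat G) else 0

theorem cool_eq_core_add {t : DyadicRat} (ht : -1 < t) (G : ShortGame) :
    of (cool t G) = of (core t G) + number (settled t G) := by
  rw [core, settled]
  split_ifs with h
  · rw [cool_of_heat_lt h, of_zero, zero_add]
  · rw [cool_of_le_heat ht (not_lt.1 h), number_zero, add_zero]

theorem IsRight.of_core {t : DyadicRat} {G x : ShortGame} (hx : IsRight x (core t G)) :
    ∃ y, IsRight y G ∧ of x + number (settled t G) = of (cool t y) + number t := by
  rw [core] at hx
  rw [settled]
  split_ifs at hx ⊢ with h
  · exact (not_isRight_zero hx).elim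
  · obtain ⟨y, hy, rfl⟩ := isRight_coolTilde.1 hx
    exact ⟨y, hy, by rw [number_zero, add_zero]; rfl⟩

theorem unsettled_core {t : DyadicRat} (ht : -1 < t) {G : ShortGame} (h : t ≤ heat G) :
    Unsettled (core t G) := by
  rw [core, if_neg (not_lt.2 h)]
  exact unsettled_coolTilde ht h

theorem core_of_heat_lt {t : DyadicRat} {G : ShortGame} (h : heat G < t) :
    of (core t G) = number 0 := by
  rw [core, if_pos h, number_zero, of_zero]

theorem unsettled_core_add {t : DyadicRat} (ht : -1 < t) {G H K : ShortGame}
    (h : t ≤ heat G ∨ t ≤ heat H ∨ t ≤ heat K) :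
    Unsettled (core t G + core t H + core t K) := by
  rcases le_or_gt t (heat G) with hG | hG <;> rcases le_or_gt t (heat H) with hH | hH <;>
  rcases le_or_gt t (heat K) with hK | hK
  · exact ((unsettled_core ht hG).add (unsettled_core ht hH)).add (unsettled_core ht hK)
  · exact ((unsettled_core ht hG).add (unsettled_core ht hH)).add_number (core_of_heat_lt hK)
  · exact ((unsettled_core ht hG).add_number (core_of_heat_lt hH)).add (unsettled_core ht hK)
  · exact ((unsettled_core ht hG).add_number (core_of_heat_lt hH)).add_number (core_of_heat_lt hK)
  · exact ((unsettled_core ht hH).number_add (core_of_heat_lt hG)).add (unsettled_core ht hK)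
  · exact ((unsettled_core ht hH).number_add (core_of_heat_lt hG)).add_number (core_of_heat_lt hK)
  · refine (unsettled_core ht hK).number_add (q := 0 + 0) ?_
    rw [of_add, core_of_heat_lt hG, core_of_heat_lt hH, ← number_add]
  · rcases h with h | h | h
    · exact absurd hG (not_lt.2 h)
    · exact absurd hH (not_lt.2 h)
    · exact absurd hK (not_lt.2 h)

theorem isRight_add_three {z A B C : ShortGame} (h : IsRight z (A + B + C)) :
    (∃ w, IsRight w A ∧ z = w + B + C) ∨ (∃ w, IsRight w B ∧ z = A + w + C) ∨
      ∃ w, IsRight w C ∧ z = A + B + w := by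
  rcases isRight_add.1 h with ⟨u, hu, rfl⟩ | ⟨w, hw, rfl⟩
  · rcases isRight_add.1 hu with ⟨w, hw, rfl⟩ | ⟨w, hw, rfl⟩
    · exact .inl ⟨w, hw, rfl⟩
    · exact .inr (.inl ⟨w, hw, rfl⟩)
  · exact .inr (.inr ⟨w, hw, rfl⟩)

theorem isLeft_add_three {z A B C : ShortGame} (h : IsLeft z (A + B + C)) :
    (∃ w, IsLeft w A ∧ z = w + B + C) ∨ (∃ w, IsLeft w B ∧ z = A + w + C) ∨
      ∃ w, IsLeft w C ∧ z = A + B + w := by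
  rcases isLeft_add.1 h with ⟨u, hu, rfl⟩ | ⟨w, hw, rfl⟩
  · rcases isLeft_add.1 hu with ⟨w, hw, rfl⟩ | ⟨w, hw, rfl⟩
    · exact .inl ⟨w, hw, rfl⟩
    · exact .inr (.inl ⟨w, hw, rfl⟩)
  · exact .inr (.inr ⟨w, hw, rfl⟩)

/-- While some summand has not frozen, the cooled sum is nonnegative as soon as Right has no good
move in an unfrozen summand. -/
theorem cool_sum_nonneg_of_active {t : DyadicRat} (ht : -1 < t) {G H K : ShortGame}
    (h : t ≤ heat G ∨ t ≤ heat H ∨ t ≤ heat K)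
    (hG : ∀ x, IsRight x G →
      ¬ of (cool t x) + of (cool t H) + of (cool t K) + number t ≤ 0)
    (hH : ∀ x, IsRight x H →
      ¬ of (cool t G) + of (cool t x) + of (cool t K) + number t ≤ 0)
    (hK : ∀ x, IsRight x K →
      ¬ of (cool t G) + of (cool t H) + of (cool t x) + number t ≤ 0) :
    0 ≤ of (cool t G) + of (cool t H) + of (cool t K) := by
  have eG := cool_eq_core_add ht G
  have eH := cool_eq_core_add ht H
  have eK := cool_eq_core_add ht K
  -- The frozen summands are moved across as one number. What remains is unsettled, so only Right's
  -- moves in the active cores have to be examined.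
  have key : number (-(settled t G + settled t H + settled t K)) ≤
      of (core t G + core t H + core t K) := by
    refine (unsettled_core_add ht h).number_le fun z hz hle => ?_
    rw [number_neg, number_add, number_add, le_neg_iff_add_nonpos_right] at hle
    rcases isRight_add_three hz with ⟨w, hw, rfl⟩ | ⟨w, hw, rfl⟩ | ⟨w, hw, rfl⟩
    · obtain ⟨y, hy, he⟩ := hw.of_core
      refine hG y hy (le_of_eq_of_le ?_ hle)
      rw [eH, eK, of_add, of_add, eq_sub_iff_add_eq.2 he.symm]
      abel
    · obtain ⟨y, hy, he⟩ := hw.of_core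
      refine hH y hy (le_of_eq_of_le ?_ hle)
      rw [eG, eK, of_add, of_add, eq_sub_iff_add_eq.2 he.symm]
      abel
    · obtain ⟨y, hy, he⟩ := hw.of_core
      refine hK y hy (le_of_eq_of_le ?_ hle)
      rw [eG, eH, of_add, of_add, eq_sub_iff_add_eq.2 he.symm]
      abel
  rw [number_neg, number_add, number_add, neg_le_iff_add_nonneg] at key
  refine key.trans_eq ?_
  rw [eG, eH, eK, of_add, of_add]
  abel

theorem IsInt.cool_eq {G : ShortGame} (h : IsInt G) (t : DyadicRat) : of (cool t G) = of G := by
  obtain ⟨k, hk⟩ := h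
  rw [(thermal_of_equiv hk t).2.2, of_eq_of.2 hk]

theorem dyadic_le_of_forall_pos {a : DyadicRat} (h : ∀ ε > 0, 0 ≤ a + 3 * ε) : 0 ≤ a := by
  by_contra ha
  have h4 := two_mul_dyadicHalf
  have h1 := h (-a * dyadicHalf ^ 2) (mul_pos (by linarith) (pow_pos (by linarith) 2))
  have h2 : 4 * dyadicHalf ^ 2 = 1 := by linear_combination (2 * dyadicHalf + 1) * h4
  nlinarith

/-- Once all summands have frozen, the cooled sum is still nonnegative, because it was so when the
last summand froze. -/
theorem cool_sum_nonneg_of_frozen {t : DyadicRat} {G H K : ShortGame}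
    (hGHK : 0 ≤ of G + of H + of K) (hG : heat G < t) (hH : heat H < t) (hK : heat K < t)
    (hact : ∀ s, -1 < s → s ≤ heat G ∨ s ≤ heat H ∨ s ≤ heat K →
      0 ≤ of (cool s G) + of (cool s H) + of (cool s K)) :
    0 ≤ of (cool t G) + of (cool t H) + of (cool t K) := by
  set s := max (max (heat G) (heat H)) (heat K) with hs
  have sG : heat G ≤ s := (le_max_left _ _).trans (le_max_left _ _)
  have sH : heat H ≤ s := (le_max_right _ _).trans (le_max_left _ _)
  have sK : heat K ≤ s := le_max_right _ _
  -- When `s ≤ -1` all three games are integers, which cooling leaves alone. Otherwise `s` is the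
  -- freezing point of a summand that is still active at `s`.
  rcases le_or_gt s (-1) with h | h
  · rwa [(isInt_of_heat_le (sG.trans h)).cool_eq, (isInt_of_heat_le (sH.trans h)).cool_eq,
      (isInt_of_heat_le (sK.trans h)).cool_eq]
  · have hmax : s ≤ heat G ∨ s ≤ heat H ∨ s ≤ heat K := by
      rw [← or_assoc, ← le_max_iff, ← le_max_iff]
    have h0 := hact s h hmax
    rw [cool_of_heat_lt hG, cool_of_heat_lt hH, cool_of_heat_lt hK, ← number_add, ← number_add,
      ← number_zero, number_le_number]
    -- The walls bound games cooled by `s` only up to an arbitrary `ε` per summand. The frozen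
    -- values are numbers, so a total error of `3ε` for every `ε` is harmless.
    refine dyadic_le_of_forall_pos fun ε hε => ?_
    have bound : ∀ X : ShortGame, heat X ≤ s →
        of (cool s X) ≤ number (leftWall X (heat X) + ε) := fun X hX =>
      (wallBounds h X).le_number _ (by rw [leftWall_of_heat_le hX]; linarith)
    have h1 := h0.trans (add_le_add (add_le_add (bound G sG) (bound H sH)) (bound K sK))
    rw [← number_add, ← number_add, ← number_zero, number_le_number] at h1
    linarith

/-- The two halves feed each other: a Right move in the first leads to a smaller instance of the
second, and a Left move in the second to a smaller instance of the first. In the second half, Left's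
winning option `x` of, say, `G` gives `x_t + H_t + K_t ≥ 0`; cancelling the other summands would
leave the forbidden `G_t ≤ x_t - t`. -/
theorem cool_sum (G H K : ShortGame) :
    (∀ t : DyadicRat, -1 < t → 0 ≤ of G + of H + of K →
      0 ≤ of (cool t G) + of (cool t H) + of (cool t K)) ∧
    ∀ t : DyadicRat, -1 < t → ¬ of G + of H + of K ≤ 0 →
      ¬ of (cool t G) + of (cool t H) + of (cool t K) + number t ≤ 0 := by
  constructor
  · intro t ht h
    -- Needed at every `s`, not just at `t`: the frozen case looks back at the largest freezing
    -- point.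
    have hact : ∀ s, -1 < s → s ≤ heat G ∨ s ≤ heat H ∨ s ≤ heat K →
        0 ≤ of (cool s G) + of (cool s H) + of (cool s K) := by
      intro s hs hmax
      have hR := (le_iff.1 (of_le_of.1 h : (0 : ShortGame) ≤ G + H + K)).2
      refine cool_sum_nonneg_of_active hs hmax (fun x hx => ?_) (fun x hx => ?_) fun x hx => ?_
      · have := hx.lt
        exact (cool_sum x H K).2 s hs
          (hR _ (isRight_add.2 (.inl ⟨_, isRight_add.2 (.inl ⟨x, hx, rfl⟩), rfl⟩)))
      · have := hx.lt
        exact (cool_sum G x K).2 s hs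
          (hR _ (isRight_add.2 (.inl ⟨_, isRight_add.2 (.inr ⟨x, hx, rfl⟩), rfl⟩)))
      · have := hx.lt
        exact (cool_sum G H x).2 s hs (hR _ (isRight_add.2 (.inr ⟨x, hx, rfl⟩)))
    by_cases hmax : t ≤ heat G ∨ t ≤ heat H ∨ t ≤ heat K
    · exact hact t ht hmax
    · simp only [not_or, not_le] at hmax
      exact cool_sum_nonneg_of_frozen h hmax.1 hmax.2.1 hmax.2.2 hact
  · intro t ht h hle
    have h : ¬ G + H + K ≤ 0 := h
    rcases not_le_iff.1 h with ⟨z, hz, h0⟩ | ⟨z, hz, -⟩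
    · rcases isLeft_add_three hz with ⟨x, hx, rfl⟩ | ⟨x, hx, rfl⟩ | ⟨x, hx, rfl⟩
      · have := hx.lt
        refine not_cool_le_cool_sub ht hx ?_
        have h1 := hle.trans ((cool_sum x H K).1 t ht h0)
        rw [← sub_nonneg] at h1 ⊢
        convert h1 using 1
        abel
      · have := hx.lt
        refine not_cool_le_cool_sub ht hx ?_
        have h1 := hle.trans ((cool_sum G x K).1 t ht h0)
        rw [← sub_nonneg] at h1 ⊢
        convert h1 using 1
        abel
      · have := hx.lt
        refine not_cool_le_cool_sub ht hx ?_
        have h1 := hle.trans ((cool_sum G H x).1 t ht h0)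
        rw [← sub_nonneg] at h1 ⊢
        convert h1 using 1
        abel
    · exact not_isRight_zero hz
termination_by G.birthday + H.birthday + K.birthday

/-! ### Cooling commutes with negation -/

theorem isLeft_neg_of_isRight {x G : ShortGame} (h : IsRight x G) : IsLeft (-x) (-G) :=
  isLeft_neg.2 ⟨x, h, rfl⟩

theorem isRight_neg_of_isLeft {x G : ShortGame} (h : IsLeft x G) : IsRight (-x) (-G) :=
  isRight_neg.2 ⟨x, h, rfl⟩

theorem neg_equiv_ofInt {G : ShortGame} {k : ℤ} (h : G ≈ ofInt k) : -G ≈ ofInt (-k) := by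
  rw [← of_eq_of, of_neg, of_eq_of.2 h, ← number_intCast, ← number_intCast, Int.cast_neg,
    number_neg]

theorem isInt_neg {G : ShortGame} : IsInt (-G) ↔ IsInt G := by
  constructor
  · rintro ⟨k, hk⟩
    refine ⟨-k, ?_⟩
    have h := of_eq_of.2 (neg_equiv_ofInt hk)
    rw [of_neg, of_neg, neg_neg] at h
    exact of_eq_of.1 h
  · rintro ⟨k, hk⟩
    exact ⟨-k, neg_equiv_ofInt hk⟩

/-- The walls of `-G` are those of `G`, negated and exchanged, and `(-G)_t = -G_t`. -/
structure NegCools (G : ShortGame) : Prop where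
  left : ∀ t, leftWall (-G) t = -rightWall G t
  right : ∀ t, rightWall (-G) t = -leftWall G t
  cool : ∀ t, of (cool t (-G)) = -of (cool t G)

theorem negCools_of_options {G : ShortGame} (hG : ¬ IsInt G) (hL : ∀ x, IsLeft x G → NegCools x)
    (hR : ∀ x, IsRight x G → NegCools x) : NegCools G := by
  have hG' : ¬ IsInt (-G) := fun h => hG (isInt_neg.1 h)
  have hl : ∀ t, leftTilde (-G) t = -rightTilde G t := fun t => by
    apply le_antisymm
    · obtain ⟨x, hx, he⟩ := exists_leftTilde_eq hG' t
      obtain ⟨y, hy, rfl⟩ := isLeft_neg.1 hx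
      have := hy.rightTilde_le t
      rw [he, (hR y hy).right]
      linarith
    · obtain ⟨x, hx, he⟩ := exists_rightTilde_eq hG t
      have := (isLeft_neg_of_isRight hx).le_leftTilde t
      rw [(hR x hx).right] at this
      rw [he]
      linarith
  have hr : ∀ t, rightTilde (-G) t = -leftTilde G t := fun t => by
    apply le_antisymm
    · obtain ⟨x, hx, he⟩ := exists_leftTilde_eq hG t
      have := (isRight_neg_of_isLeft hx).rightTilde_le t
      rw [(hL x hx).left] at this
      rw [he]
      linarith
    · obtain ⟨x, hx, he⟩ := exists_rightTilde_eq hG' t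
      obtain ⟨y, hy, rfl⟩ := isRight_neg.1 hx
      have := hy.le_leftTilde t
      rw [he, (hL y hy).left]
      linarith
  have hf : freezing (-G) = freezing G := by
    simp only [freezing, hl, hr, neg_inj, eq_comm]
  have hτ := leftTilde_freezing hG
  refine ⟨fun t => ?_, fun t => ?_, fun t => ?_⟩
  · rw [leftWall_eq hG', rightWall_eq hG, hf, hl, hl, hτ]
    split_ifs <;> rfl
  · rw [rightWall_eq hG', leftWall_eq hG, hf, hr, hl, hτ]
    split_ifs <;> rfl
  · rw [cool_eq hG', cool_eq hG, hf, hl, hτ]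
    split_ifs
    · have eR : ∀ x, IsRight x G →
          of (ShortGame.cool t (-x) - ofDyadic t) = of (-(ShortGame.cool t x + ofDyadic t)) :=
        fun x hx => by rw [of_sub, (hR x hx).cool, of_neg, of_add]; abel
      have eL : ∀ x, IsLeft x G →
          of (ShortGame.cool t (-x) + ofDyadic t) = of (-(ShortGame.cool t x - ofDyadic t)) :=
        fun x hx => by rw [of_add, (hL x hx).cool, of_neg, of_sub]; abel
      rw [← of_neg]
      -- The options of the two games agree only in value (`eL`, `eR`), so each inequality is
      -- checked option by option, using that no Left option is `≥` its game and no Right option is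
      -- `≤` it.
      apply le_antisymm
      · refine of_le_of.2 (le_iff.2 ⟨fun z hz h => ?_, fun z hz h => ?_⟩)
        · obtain ⟨y, hy, rfl⟩ := isLeft_coolTilde.1 hz
          obtain ⟨x, hx, rfl⟩ := isLeft_neg.1 hy
          have h' := (of_le_of.2 h).trans_eq (eR x hx)
          exact (isLeft_neg_of_isRight (isRight_coolTilde.2 ⟨x, hx, rfl⟩)).not_le h'
        · obtain ⟨y, hy, rfl⟩ := isRight_neg.1 hz
          obtain ⟨x, hx, rfl⟩ := isLeft_coolTilde.1 hy
          have h' := (eL x hx).le.trans (of_le_of.2 h)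
          exact (isRight_coolTilde.2 ⟨-x, isRight_neg_of_isLeft hx, rfl⟩).not_le h'
      · refine of_le_of.2 (le_iff.2 ⟨fun z hz h => ?_, fun z hz h => ?_⟩)
        · obtain ⟨y, hy, rfl⟩ := isLeft_neg.1 hz
          obtain ⟨x, hx, rfl⟩ := isRight_coolTilde.1 hy
          have h' := (of_le_of.2 h).trans_eq (eR x hx).symm
          exact (isLeft_coolTilde.2 ⟨-x, isLeft_neg_of_isRight hx, rfl⟩).not_le h'
        · obtain ⟨y, hy, rfl⟩ := isRight_coolTilde.1 hz
          obtain ⟨x, hx, rfl⟩ := isRight_neg.1 hy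
          have h' := (eL x hx).ge.trans (of_le_of.2 h)
          exact (isRight_neg_of_isLeft (isLeft_coolTilde.2 ⟨x, hx, rfl⟩)).not_le h'
    · exact number_neg _

theorem negCools (G : ShortGame) : NegCools G := by
  by_cases hG : IsInt G
  · obtain ⟨k, hk⟩ := hG
    have hk' := neg_equiv_ofInt hk
    refine ⟨fun t => ?_, fun t => ?_, fun t => ?_⟩
    · rw [(thermal_of_equiv hk t).2.1, (thermal_of_equiv hk' t).1, Int.cast_neg]
    · rw [(thermal_of_equiv hk t).1, (thermal_of_equiv hk' t).2.1, Int.cast_neg]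
    · rw [IsInt.cool_eq ⟨k, hk⟩, IsInt.cool_eq ⟨_, hk'⟩, of_neg]
  · exact negCools_of_options hG (fun x hx => have := hx.lt; negCools x)
      fun x hx => have := hx.lt; negCools x
termination_by G.birthday

theorem of_cool_neg (t : DyadicRat) (G : ShortGame) : of (cool t (-G)) = -of (cool t G) :=
  (negCools G).cool t

/-! ### Additivity and invariance from vanishing triple sums -/

theorem cool_add_cool_add_cool_eq_zero {t : DyadicRat} (ht : -1 < t) {G H K : ShortGame}
    (h : of G + of H + of K = 0) : of (cool t G) + of (cool t H) + of (cool t K) = 0 := by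
  apply le_antisymm
  · have h1 := (cool_sum (-G) (-H) (-K)).1 t ht (by
      rw [of_neg, of_neg, of_neg, ← neg_add, ← neg_add, h, neg_zero])
    rwa [of_cool_neg, of_cool_neg, of_cool_neg, ← neg_add, ← neg_add, neg_nonneg] at h1
  · exact (cool_sum G H K).1 t ht h.ge

theorem of_cool_add {t : DyadicRat} (ht : -1 < t) (G H : ShortGame) :
    of (cool t (G + H)) = of (cool t G) + of (cool t H) := by
  have h := cool_add_cool_add_cool_eq_zero ht (G := G) (H := H) (K := -(G + H))
    (by rw [of_neg, of_add, add_neg_cancel])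
  rw [of_cool_neg, add_neg_eq_zero] at h
  exact h.symm

theorem of_cool_congr {t : DyadicRat} (ht : -1 < t) {G H : ShortGame} (h : G ≈ H) :
    of (cool t G) = of (cool t H) := by
  have h0 : of (cool t 0) = 0 := IsInt.cool_eq (G := 0) ⟨0, Setoid.refl _⟩ t
  have h1 := cool_add_cool_add_cool_eq_zero ht (G := G) (H := -H) (K := 0)
    (by rw [of_neg, of_eq_of.2 h, add_neg_cancel, zero_add, of_zero])
  rwa [of_cool_neg, h0, add_zero, add_neg_eq_zero] at h1

end ShortGame

theorem theorem6p2 (t : DyadicRat) (ht : -1 < t) :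
    (∀ G H : ShortGame,
      ShortGame.cool t (G + H) ≈ ShortGame.cool t G + ShortGame.cool t H) ∧
    ∃ φ : GameValue →+ GameValue,
      ∀ G : ShortGame, φ (GameValue.of G) = GameValue.of (ShortGame.cool t G) := by
  refine ⟨fun G H => GameValue.of_eq_of.1 (ShortGame.of_cool_add ht G H), ?_⟩
  refine ⟨AddMonoidHom.mk' (Quotient.lift (fun G => GameValue.of (ShortGame.cool t G))
    fun G H h => ShortGame.of_cool_congr ht h) fun x y => ?_, fun G => rfl⟩
  induction x using Quotient.inductionOn
  induction y using Quotient.inductionOn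
  exact ShortGame.of_cool_add ht _ _
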